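/- Let $K$ be a field, let $S=K[x_1,\dots,x_n]$ with its standard grading ($\deg x_k=1$), and let $I$ and $J$ be nonzero monomial ideals of $S$, i.e. ideals generated by monomials. For an ideal $L$ of $S$ let $\operatorname{projdim}(L)$ denote the projective dimension of $L$ as an $S$-module. For a nonzero graded ideal $L$ let $$\operatorname{reg}(L)=\max\{\,j-i : i\ge 0,\ j\in\mathbb Z,\ \operatorname{Tor}_i^S(K,L)_j\neq 0\,\}$$ denote its Castelnuovo–Mumford regularity, where $K=S/(x_1,\dots,x_n)$ and $\operatorname{Tor}_i^S(K,L)_j$ is the degree $j$ component of $\operatorname{Tor}_i^S(K,L)$. Then: (a) $\operatorname{projdim}(I+J)\le \operatorname{projdim}(I)+\operatorname{projdim}(J)+1$; (b) if $I$ and $J$ are not both equal to $S$, then the regularities of $I$, $J$ and $I+J$ exist (the maxima above are attained), and $\operatorname{reg}(I+J)\le \operatorname{reg}(I)+\operatorname{reg}(J)-1$. -/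

import Mathlib

open CategoryTheory MvPolynomial

universe u

/-- A monomial ideal of `K[x₁, …, xₙ]`: an ideal generated by a set of monomials. -/
def IsMonomialIdeal {K : Type u} [Field K] {n : ℕ} (I : Ideal (MvPolynomial (Fin n) K)) : Prop :=
  ∃ A : Set (Fin n →₀ ℕ), I = Ideal.span ((fun a => monomial a (1 : K)) '' A)

/-- A ℤ-graded free resolution, with all terms of finite rank, of the graded ideal `L` of the
standard graded ring `S = K[x₁, …, xₙ]`:
`⋯ ⟶ F₂ ⟶ F₁ ⟶ F₀ ⟶ L ⟶ 0`, with `Fᵢ = ⨁_b S(-deg i b)`.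
The module `Fᵢ` is `Fin (rank i) → S`, whose standard basis vector `e_b` has degree `deg i b`.
The augmentation maps `e_b` to `gen b`, and `Fᵢ₊₁ ⟶ Fᵢ` is given by the matrix `diff i`;
`gen_homogeneous` and `diff_homogeneous` say that these maps are homogeneous of degree `0`. -/
structure GradedFreeResolution {K : Type u} [Field K] {n : ℕ}
    (L : Ideal (MvPolynomial (Fin n) K)) where
  rank : ℕ → ℕ
  deg : ∀ i, Fin (rank i) → ℤ
  gen : Fin (rank 0) → MvPolynomial (Fin n) K
  diff : ∀ i, Matrix (Fin (rank i)) (Fin (rank (i + 1))) (MvPolynomial (Fin n) K)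
  gen_homogeneous : ∀ b, ∀ m ∈ (gen b).support, (m.degree : ℤ) = deg 0 b
  diff_homogeneous : ∀ i c b, ∀ m ∈ (diff i c b).support,
    (m.degree : ℤ) + deg i c = deg (i + 1) b
  range_gen : LinearMap.range (Fintype.linearCombination (MvPolynomial (Fin n) K) gen) = L
  exact_zero : LinearMap.range (diff 0).mulVecLin =
    LinearMap.ker (Fintype.linearCombination (MvPolynomial (Fin n) K) gen)
  exact_succ : ∀ i, LinearMap.range (diff (i + 1)).mulVecLin =
    LinearMap.ker (diff i).mulVecLin

namespace GradedFreeResolution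

variable {K : Type u} [Field K] {n : ℕ} {L : Ideal (MvPolynomial (Fin n) K)}

/-- The degree `j` component of `K ⊗_S Fᵢ = ⨁_b K(-deg i b)`: the vectors supported on the
basis elements of degree `j`. -/
def degreePart (F : GradedFreeResolution L) (i : ℕ) (j : ℤ) :
    Submodule K (Fin (F.rank i) → K) where
  carrier := {v | ∀ b, F.deg i b ≠ j → v b = 0}
  add_mem' {v w} hv hw b hb := by simp [hv b hb, hw b hb]
  zero_mem' _ _ := rfl
  smul_mem' c v hv b hb := by simp [hv b hb]

/-- The differential `K ⊗_S Fᵢ₊₁ ⟶ K ⊗_S Fᵢ`, where `K = S / (x₁, …, xₙ)`: the entries of the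
matrix are reduced modulo the variables, that is, replaced by their constant coefficients. -/
noncomputable def diffK (F : GradedFreeResolution L) (i : ℕ) :
    (Fin (F.rank (i + 1)) → K) →ₗ[K] (Fin (F.rank i) → K) :=
  ((F.diff i).map (constantCoeff (R := K) (σ := Fin n))).mulVecLin

/-- The cycles of degree `j` of the complex `K ⊗_S F` at position `i`. -/
noncomputable def cycles (F : GradedFreeResolution L) :
    ∀ (i : ℕ) (_ : ℤ), Submodule K (Fin (F.rank i) → K)
  | 0, j => F.degreePart 0 j
  | i + 1, j => F.degreePart (i + 1) j ⊓ LinearMap.ker (F.diffK i)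

/-- The boundaries of degree `j` of the complex `K ⊗_S F` at position `i`. -/
noncomputable def boundaries (F : GradedFreeResolution L) (i : ℕ) (j : ℤ) :
    Submodule K (Fin (F.rank i) → K) :=
  (F.degreePart (i + 1) j).map (F.diffK i)

/-- `Tor_i^S(K, L)_j`, computed with the resolution `F`: the degree `j` component of the
homology of `K ⊗_S F` at position `i`. -/
abbrev Tor (F : GradedFreeResolution L) (i : ℕ) (j : ℤ) : Type u :=
  F.cycles i j ⧸ (F.boundaries i j).comap (F.cycles i j).subtype

end GradedFreeResolution

/-- `Tor_i^S(K, L)_j ≠ 0`, for a graded ideal `L`. Such an ideal has a graded free resolution,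
and `Tor` does not depend on the one that is used to compute it. -/
def TorNonzero {K : Type u} [Field K] {n : ℕ} (L : Ideal (MvPolynomial (Fin n) K))
    (i : ℕ) (j : ℤ) : Prop :=
  ∃ F : GradedFreeResolution L, Nontrivial (F.Tor i j)

/-- `r` is the Castelnuovo–Mumford regularity of the graded ideal `L`:
`r = max {j - i : Tor_i^S(K, L)_j ≠ 0}`. -/
def IsRegularity {K : Type u} [Field K] {n : ℕ} (L : Ideal (MvPolynomial (Fin n) K))
    (r : ℤ) : Prop :=
  IsGreatest {d : ℤ | ∃ (i : ℕ) (j : ℤ), TorNonzero L i j ∧ d = j - i} r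

/-! A multigraded free resolution of `S ⧸ I` is a complex of `K`-vector spaces with a basis labelled
by exponents (`LabeledComplex`). In multidegree `c` it is the subcomplex of labels at most `c`. So
it resolves `S ⧸ I` when these parts are exact for every `c` that is the exponent of a monomial in
`I`. For other `c` only the base element of label `0` remains.

Given such complexes for `I` and `J`, tensor them over `K` and label each pair by the least common
multiple. A least common multiple is at most `c` exactly when both labels are, so the part at `c` is
the tensor product of the parts. It is contractible as soon as one factor is, which holds for all
`c` in `I + J` (`IsResolution.prod`). Hence the product resolves `S ⧸ (I + J)`, in general not
minimally.

Positions add, and the degree of a least common multiple is at most the sum of the degrees. If the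
factors are minimal, their positions and labels are controlled by projective dimension
(`IsMinimal.rank_eq_zero`) and by `Tor` (`IsMinimal.torNonzero`). For the product only upper bounds
are needed, and any resolution gives them (`hasProjectiveDimensionLE_of_rank_eq_zero`,
`exists_deg_eq_of_torNonzero`). Finite minimal complexes come from `exists_isMinimal_isResolution`.
-/

/-! ### Comparison of graded free resolutions -/

namespace GradedFreeResolution

open Matrix

variable {K : Type u} [Field K] {n : ℕ} {L : Ideal (MvPolynomial (Fin n) K)}

/-- The syzygies inside the `i`-th free module: the kernel of the augmentation if `i = 0`,
and of the differential leaving the `i`-th free module otherwise. -/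
noncomputable def syzygies (F : GradedFreeResolution L) :
    ∀ i, Submodule (MvPolynomial (Fin n) K) (Fin (F.rank i) → MvPolynomial (Fin n) K)
  | 0 => LinearMap.ker (Fintype.linearCombination (MvPolynomial (Fin n) K) F.gen)
  | i + 1 => LinearMap.ker (F.diff i).mulVecLin

lemma range_diff (F : GradedFreeResolution L) (i : ℕ) :
    LinearMap.range (F.diff i).mulVecLin = F.syzygies i := by
  cases i with
  | zero => exact F.exact_zero
  | succ i => exact F.exact_succ i

lemma mem_syzygies_succ (F : GradedFreeResolution L) {i : ℕ}
    {v : Fin (F.rank (i + 1)) → MvPolynomial (Fin n) K} :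
    v ∈ F.syzygies (i + 1) ↔ F.diff i *ᵥ v = 0 := by
  simp [syzygies]

lemma diff_mulVec_mem (F : GradedFreeResolution L) (i : ℕ)
    (v : Fin (F.rank (i + 1)) → MvPolynomial (Fin n) K) : F.diff i *ᵥ v ∈ F.syzygies i := by
  rw [← F.range_diff]
  exact ⟨v, rfl⟩

/-- A matrix of polynomials is homogeneous of degree `0` between the graded free modules whose
basis elements have the degrees `d` (source) and `e` (target). -/
def IsHomogeneousMatrix {α β : Type*} (e : α → ℤ) (d : β → ℤ)
    (M : Matrix α β (MvPolynomial (Fin n) K)) : Prop :=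
  ∀ c b, ∀ m ∈ (M c b).support, (m.degree : ℤ) + e c = d b

lemma IsHomogeneousMatrix.mul {α β γ : Type*} [Fintype β] {e : α → ℤ} {d : β → ℤ} {f : γ → ℤ}
    {M : Matrix α β (MvPolynomial (Fin n) K)} {N : Matrix β γ (MvPolynomial (Fin n) K)}
    (hM : IsHomogeneousMatrix e d M) (hN : IsHomogeneousMatrix d f N) :
    IsHomogeneousMatrix e f (M * N) := by
  classical
  intro c b m hm
  rw [mem_support_iff, Matrix.mul_apply, coeff_sum] at hm
  obtain ⟨x, -, hx⟩ := Finset.exists_ne_zero_of_sum_ne_zero hm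
  rw [coeff_mul] at hx
  obtain ⟨⟨p, q⟩, hpq, hx⟩ := Finset.exists_ne_zero_of_sum_ne_zero hx
  have h1 := hM c x p (mem_support_iff.2 (left_ne_zero_of_mul hx))
  have h2 := hN x b q (mem_support_iff.2 (right_ne_zero_of_mul hx))
  rw [Finset.HasAntidiagonal.mem_antidiagonal] at hpq
  rw [← hpq, ← h2, ← h1, map_add]
  push_cast
  ring

lemma IsHomogeneousMatrix.sub {α β : Type*} {e : α → ℤ} {d : β → ℤ}
    {M N : Matrix α β (MvPolynomial (Fin n) K)}
    (hM : IsHomogeneousMatrix e d M) (hN : IsHomogeneousMatrix e d N) :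
    IsHomogeneousMatrix e d (M - N) := by
  intro c b m hm
  by_cases h : m ∈ (M c b).support
  · exact hM c b m h
  · refine hN c b m ?_
    rw [mem_support_iff, Matrix.sub_apply, coeff_sub] at hm
    rw [notMem_support_iff] at h
    rw [mem_support_iff]
    simpa [h] using hm

lemma isHomogeneousMatrix_one {α : Type*} [DecidableEq α] (e : α → ℤ) :
    IsHomogeneousMatrix e e (1 : Matrix α α (MvPolynomial (Fin n) K)) := by
  classical
  intro c b m hm
  by_cases h : c = b
  · subst h
    rw [Matrix.one_apply_eq, mem_support_iff, coeff_one] at hm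
    have : m = 0 := by
      by_contra h
      exact hm (if_neg (Ne.symm h))
    simp [this]
  · simp [Matrix.one_apply_ne h] at hm

lemma exists_coeff_eq_ite (p : MvPolynomial (Fin n) K) (P : (Fin n →₀ ℕ) → Prop)
    [DecidablePred P] :
    ∃ q : MvPolynomial (Fin n) K, ∀ m, coeff m q = if P m then coeff m p else 0 := by
  classical
  refine ⟨∑ x ∈ p.support with P x, monomial x (coeff x p), fun m => ?_⟩
  simp only [coeff_sum, coeff_monomial, Finset.sum_ite_eq', Finset.mem_filter, mem_support_iff]
  by_cases h1 : P m <;> by_cases h2 : coeff m p = 0 <;> simp [h1, h2]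

/-- If the columns of a homogeneous matrix `M` lie in the column space of a homogeneous matrix `D`,
then `M` factors through `D` by a homogeneous matrix. -/
lemma IsHomogeneousMatrix.exists_mul_eq {α β γ : Type*} [Fintype β] {e : α → ℤ} {d : β → ℤ}
    {f : γ → ℤ} {D : Matrix α β (MvPolynomial (Fin n) K)} (hD : IsHomogeneousMatrix e d D)
    {M : Matrix α γ (MvPolynomial (Fin n) K)} (hM : IsHomogeneousMatrix e f M)
    (hs : ∀ b, M.col b ∈ LinearMap.range D.mulVecLin) :
    ∃ N : Matrix β γ (MvPolynomial (Fin n) K), IsHomogeneousMatrix d f N ∧ D * N = M := by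
  classical
  simp_rw [LinearMap.mem_range] at hs
  choose w hw using hs
  -- Keep only the terms that homogeneity allows. Since `D` and `M` are homogeneous, the discarded
  -- terms cannot contribute to `M`.
  choose N hN using fun a b => exists_coeff_eq_ite (w b a)
    (fun m => (m.degree : ℤ) + d a = f b)
  refine ⟨Matrix.of N, fun a b m hm => ?_, ?_⟩
  · rw [Matrix.of_apply, mem_support_iff, hN] at hm
    by_contra h
    exact hm (if_neg h)
  · ext c b m
    have hcb : M c b = ∑ a, D c a * w b a := (congrFun (hw b) c).symm
    rw [Matrix.mul_apply, coeff_sum]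
    by_cases h : (m.degree : ℤ) + e c = f b
    · rw [hcb, coeff_sum]
      refine Finset.sum_congr rfl fun a _ => ?_
      rw [coeff_mul, coeff_mul]
      refine Finset.sum_congr rfl fun pq hpq => ?_
      by_cases h0 : coeff pq.1 (D c a) = 0
      · rw [h0, zero_mul, zero_mul]
      · have h1 := hD c a pq.1 (mem_support_iff.2 h0)
        rw [Finset.HasAntidiagonal.mem_antidiagonal] at hpq
        rw [Matrix.of_apply, hN, if_pos]
        rw [← h, ← hpq, map_add, ← h1]
        push_cast
        ring
    · have h2 : coeff m (M c b) = 0 := by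
        by_contra h0
        exact h (hM c b m (mem_support_iff.2 h0))
      rw [h2]
      refine Finset.sum_eq_zero fun a _ => ?_
      rw [coeff_mul]
      refine Finset.sum_eq_zero fun pq hpq => ?_
      by_contra h0
      have h1 := hD c a pq.1 (mem_support_iff.2 (left_ne_zero_of_mul h0))
      have h3 := right_ne_zero_of_mul h0
      rw [Matrix.of_apply, hN] at h3
      have h4 : (pq.2.degree : ℤ) + d a = f b := by
        by_contra h4
        exact h3 (if_neg h4)
      rw [Finset.HasAntidiagonal.mem_antidiagonal] at hpq
      apply h
      rw [← hpq, ← h4, map_add, ← h1]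
      push_cast
      ring

/-- A homogeneous matrix whose columns are syzygies factors through the differential by a
homogeneous matrix. -/
lemma exists_lift (G : GradedFreeResolution L) (i : ℕ) {β : Type*} {d : β → ℤ}
    {M : Matrix (Fin (G.rank i)) β (MvPolynomial (Fin n) K)}
    (hM : IsHomogeneousMatrix (G.deg i) d M) (hs : ∀ b, M.col b ∈ G.syzygies i) :
    ∃ N : Matrix (Fin (G.rank (i + 1))) β (MvPolynomial (Fin n) K),
      IsHomogeneousMatrix (G.deg (i + 1)) d N ∧ G.diff i * N = M :=
  IsHomogeneousMatrix.exists_mul_eq (G.diff_homogeneous i) hM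
    (fun b => by rw [G.range_diff]; exact hs b)

lemma exists_lift_gen (F G : GradedFreeResolution L) :
    ∃ φ : Matrix (Fin (G.rank 0)) (Fin (F.rank 0)) (MvPolynomial (Fin n) K),
      IsHomogeneousMatrix (G.deg 0) (F.deg 0) φ ∧
      ∀ v, Fintype.linearCombination (MvPolynomial (Fin n) K) G.gen (φ *ᵥ v) =
        Fintype.linearCombination (MvPolynomial (Fin n) K) F.gen v := by
  have key (H : GradedFreeResolution L) (v : Fin (H.rank 0) → MvPolynomial (Fin n) K) :
      Fintype.linearCombination (MvPolynomial (Fin n) K) H.gen v =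
        (replicateRow Unit H.gen *ᵥ v) () := by
    simp [Fintype.linearCombination_apply, mulVec, dotProduct, mul_comm]
  have hom (H : GradedFreeResolution L) :
      IsHomogeneousMatrix (fun _ => 0) (H.deg 0) (replicateRow Unit H.gen) := by
    intro c b m hm
    simpa using H.gen_homogeneous b m hm
  obtain ⟨φ, h1, h2⟩ := (hom G).exists_mul_eq (hom F) (fun b => by
    obtain ⟨w, hw⟩ := (F.range_gen.trans G.range_gen.symm).le ⟨Pi.single b 1, rfl⟩
    refine ⟨w, funext fun _ => ?_⟩
    rw [key] at hw
    simpa using hw)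
  exact ⟨φ, h1, fun v => by rw [key, key, mulVec_mulVec, h2]⟩

lemma isHomogeneousMatrix_diff (F : GradedFreeResolution L) (i : ℕ) :
    IsHomogeneousMatrix (F.deg i) (F.deg (i + 1)) (F.diff i) :=
  F.diff_homogeneous i

lemma exists_dependent_sequence {α : ℕ → Type*} (P : ∀ i, α i → Prop)
    (R : ∀ i, α i → α (i + 1) → Prop) (h0 : ∃ a, P 0 a)
    (hs : ∀ i a, P i a → ∃ a', R i a a' ∧ P (i + 1) a') :
    ∃ f : ∀ i, α i, (∀ i, P i (f i)) ∧ ∀ i, R i (f i) (f (i + 1)) := by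
  choose a0 ha0 using h0
  choose g hg using hs
  let s : ∀ i, {a : α i // P i a} :=
    fun i => Nat.rec ⟨a0, ha0⟩ (fun i a => ⟨g i a.1 a.2, (hg i a.1 a.2).2⟩) i
  exact ⟨fun i => (s i).1, fun i => (s i).2, fun i => (hg i (s i).1 (s i).2).1⟩

/-- A degree `0` chain map between resolutions that lifts the identity of `L`. -/
lemma exists_chainMap (F G : GradedFreeResolution L) :
    ∃ φ : ∀ i, Matrix (Fin (G.rank i)) (Fin (F.rank i)) (MvPolynomial (Fin n) K),
      (∀ i, IsHomogeneousMatrix (G.deg i) (F.deg i) (φ i)) ∧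
      (∀ v, Fintype.linearCombination (MvPolynomial (Fin n) K) G.gen (φ 0 *ᵥ v) =
        Fintype.linearCombination (MvPolynomial (Fin n) K) F.gen v) ∧
      ∀ i, G.diff i * φ (i + 1) = φ i * F.diff i := by
  classical
  obtain ⟨φ0, hφ0, hgen⟩ := exists_lift_gen F G
  -- Mapping syzygies to syzygies is what permits the next lift; the last clause remembers the start
  -- of the sequence, hence its compatibility with the augmentations.
  obtain ⟨φ, h1, h2⟩ := exists_dependent_sequence
    (α := fun i => Matrix (Fin (G.rank i)) (Fin (F.rank i)) (MvPolynomial (Fin n) K))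
    (fun i φ => IsHomogeneousMatrix (G.deg i) (F.deg i) φ ∧
      (∀ v ∈ F.syzygies i, φ *ᵥ v ∈ G.syzygies i) ∧
      ∀ h : i = 0, h ▸ φ = φ0)
    (fun i φ φ' => G.diff i * φ' = φ * F.diff i)
    ⟨φ0, hφ0, fun v hv => by
      change _ = _ at hv
      change _ = _
      rw [hgen, hv], fun _ => rfl⟩
    (fun i φ hφ => by
      obtain ⟨φ', h, h'⟩ := G.exists_lift i (hφ.1.mul (F.isHomogeneousMatrix_diff i))
        (fun b => by
          have : (φ * F.diff i).col b = φ *ᵥ (F.diff i *ᵥ Pi.single b 1) := by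
            rw [mulVec_mulVec, mulVec_single_one]
          rw [this]
          exact hφ.2.1 _ (F.diff_mulVec_mem i _))
      refine ⟨φ', h', h, fun v hv => ?_, fun h => by simp at h⟩
      rw [mem_syzygies_succ] at hv ⊢
      rw [mulVec_mulVec, h', ← mulVec_mulVec, hv, mulVec_zero])
  refine ⟨φ, fun i => (h1 i).1, ?_, h2⟩
  have : φ 0 = φ0 := (h1 0).2.2 rfl
  rw [this]
  exact hgen

/-- A degree `0` endomorphism of a resolution that lifts the zero map is null-homotopic. -/
lemma exists_homotopy (F : GradedFreeResolution L)
    (θ : ∀ i, Matrix (Fin (F.rank i)) (Fin (F.rank i)) (MvPolynomial (Fin n) K))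
    (hθ : ∀ i, IsHomogeneousMatrix (F.deg i) (F.deg i) (θ i))
    (h0 : ∀ v, θ 0 *ᵥ v ∈ F.syzygies 0)
    (hs : ∀ i, F.diff i * θ (i + 1) = θ i * F.diff i) :
    ∃ h : ∀ i, Matrix (Fin (F.rank (i + 1))) (Fin (F.rank i)) (MvPolynomial (Fin n) K),
      (∀ i, IsHomogeneousMatrix (F.deg (i + 1)) (F.deg i) (h i)) ∧
      F.diff 0 * h 0 = θ 0 ∧
      ∀ i, F.diff (i + 1) * h (i + 1) = θ (i + 1) - h i * F.diff i := by
  have col_eq {α β : Type} [Fintype β] [DecidableEq β]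
      (M : Matrix α β (MvPolynomial (Fin n) K)) (b : β) :
      M.col b = M *ᵥ Pi.single b 1 := by rw [mulVec_single_one]
  obtain ⟨h0', hh0, hd0⟩ := F.exists_lift 0 (hθ 0) (fun b => by rw [col_eq]; exact h0 _)
  -- The invariant `d h = θ` on syzygies makes the columns of `θ (i + 1) - h d` syzygies, so that
  -- they lift again.
  obtain ⟨h, h1, h2⟩ := exists_dependent_sequence
    (α := fun i => Matrix (Fin (F.rank (i + 1))) (Fin (F.rank i)) (MvPolynomial (Fin n) K))
    (fun i h => IsHomogeneousMatrix (F.deg (i + 1)) (F.deg i) h ∧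
      (∀ v ∈ F.syzygies i, F.diff i *ᵥ (h *ᵥ v) = θ i *ᵥ v) ∧
      (i = 0 → F.diff i * h = θ i))
    (fun i h h' => F.diff (i + 1) * h' = θ (i + 1) - h * F.diff i)
    ⟨h0', hh0, fun v _ => by rw [mulVec_mulVec, hd0], fun _ => hd0⟩
    (fun i h hh => by
      obtain ⟨h', hh', hd'⟩ := F.exists_lift (i + 1)
        ((hθ (i + 1)).sub (hh.1.mul (F.isHomogeneousMatrix_diff i))) (fun b => by
          rw [col_eq, mem_syzygies_succ, sub_mulVec, mulVec_sub, mulVec_mulVec, hs,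
            ← mulVec_mulVec _ (θ i), ← mulVec_mulVec _ h,
            hh.2.1 _ (F.diff_mulVec_mem i _), mulVec_mulVec, sub_self])
      refine ⟨h', hd', hh', fun v hv => ?_, fun h => by simp at h⟩
      rw [mem_syzygies_succ] at hv
      rw [mulVec_mulVec, hd', sub_mulVec, ← mulVec_mulVec, hv, mulVec_zero, sub_zero])
  exact ⟨h, fun i => (h1 i).1, (h1 0).2.2 rfl, h2⟩

/-- Comparison maps in both directions compose to a map homotopic to the identity. In position `0`
no differential leaves, so the term with `h'` is absent. -/
lemma exists_contraction (F G : GradedFreeResolution L) (i : ℕ) :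
    ∃ (φ : Matrix (Fin (G.rank i)) (Fin (F.rank i)) (MvPolynomial (Fin n) K))
      (ψ : Matrix (Fin (F.rank i)) (Fin (G.rank i)) (MvPolynomial (Fin n) K))
      (h : Matrix (Fin (F.rank (i + 1))) (Fin (F.rank i)) (MvPolynomial (Fin n) K)),
      IsHomogeneousMatrix (G.deg i) (F.deg i) φ ∧
      IsHomogeneousMatrix (F.deg (i + 1)) (F.deg i) h ∧
      match i with
      | 0 => F.diff 0 * h = 1 - ψ * φ
      | i + 1 => ∃ h' : Matrix (Fin (F.rank (i + 1))) (Fin (F.rank i)) (MvPolynomial (Fin n) K),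
        F.diff (i + 1) * h = 1 - ψ * φ - h' * F.diff i := by
  obtain ⟨φ, φ1, φ2, φ3⟩ := exists_chainMap F G
  obtain ⟨ψ, ψ1, ψ2, ψ3⟩ := exists_chainMap G F
  obtain ⟨h, h1, h2, h3⟩ := F.exists_homotopy (fun i => 1 - ψ i * φ i)
    (fun i => (isHomogeneousMatrix_one _).sub ((ψ1 i).mul (φ1 i)))
    (fun v => by
      change _ = _
      rw [sub_mulVec, map_sub, one_mulVec, ← mulVec_mulVec, ψ2, φ2, sub_self])
    (fun i => by
      rw [Matrix.mul_sub, Matrix.sub_mul, Matrix.mul_one, Matrix.one_mul, ← Matrix.mul_assoc, ψ3,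
        Matrix.mul_assoc, φ3, Matrix.mul_assoc])
  refine ⟨φ i, ψ i, h i, φ1 i, h1 i, ?_⟩
  cases i with
  | zero => exact h2
  | succ i => exact ⟨h i, h3 i⟩

/-- If some resolution of `L` has no basis element of degree `j` in position `i`, then
`Tor_i(K, L)_j = 0`, with whichever resolution it is computed. -/
theorem exists_deg_eq_of_torNonzero (G : GradedFreeResolution L) {i : ℕ} {j : ℤ}
    (hT : TorNonzero L i j) : ∃ b, G.deg i b = j := by
  obtain ⟨F, hF⟩ := hT
  by_contra! hG
  rw [Submodule.Quotient.nontrivial_iff, Ne, Submodule.comap_subtype_eq_top] at hF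
  apply hF
  obtain ⟨φ, ψ, h, hφ, hh, hd⟩ := exists_contraction F G i
  intro v hv
  let cc := constantCoeff (R := K) (σ := Fin n)
  have hcc {α β : Type} {e : α → ℤ} {d : β → ℤ} {M : Matrix α β (MvPolynomial (Fin n) K)}
      (hM : IsHomogeneousMatrix e d M) {a : α} {b : β} (hab : M.map cc a b ≠ 0) : e a = d b := by
    simpa using hM a b 0 (by rwa [mem_support_iff, ← constantCoeff_eq])
  have hv' : v ∈ F.degreePart i j := by
    cases i with
    | zero => exact hv
    | succ i => exact hv.1
  -- Modulo the variables, a homogeneous matrix only links basis elements of equal degree, and `G`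
  -- has none of degree `j`.
  have hφv : φ.map cc *ᵥ v = 0 := by
    funext c
    rw [mulVec, dotProduct, Pi.zero_apply]
    refine Finset.sum_eq_zero fun b _ => ?_
    by_contra h0
    exact hG c ((hcc hφ (left_ne_zero_of_mul h0)).trans
      (not_not.1 fun hb => right_ne_zero_of_mul h0 (hv' b hb)))
  -- With `φ v = 0` and `v` a cycle, the homotopy formula reduces to `d (h v) = v`.
  refine ⟨h.map cc *ᵥ v, fun c hc => ?_, ?_⟩
  · rw [mulVec, dotProduct]
    refine Finset.sum_eq_zero fun b _ => ?_
    by_contra h0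
    exact hc ((hcc hh (left_ne_zero_of_mul h0)).trans
      (not_not.1 fun hb => right_ne_zero_of_mul h0 (hv' b hb)))
  · change (F.diff i).map cc *ᵥ (h.map cc *ᵥ v) = v
    rw [mulVec_mulVec, ← Matrix.map_mul]
    cases i with
    | zero =>
      rw [hd, Matrix.map_sub _ (map_sub cc), Matrix.map_mul,
        Matrix.map_one _ (map_zero cc) (map_one cc), sub_mulVec,
        one_mulVec, ← mulVec_mulVec, hφv, mulVec_zero, sub_zero]
    | succ i =>
      obtain ⟨h', hd⟩ := hd
      have hc : (F.diff i).map cc *ᵥ v = 0 := hv.2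
      rw [hd, Matrix.map_sub _ (map_sub cc), Matrix.map_sub _ (map_sub cc), Matrix.map_mul,
        Matrix.map_mul, Matrix.map_one _ (map_zero cc) (map_one cc), sub_mulVec, sub_mulVec,
        one_mulVec, ← mulVec_mulVec, hφv, mulVec_zero, sub_zero, ← mulVec_mulVec, hc, mulVec_zero,
        sub_zero]

end GradedFreeResolution

/-! ### Dimension shifting and a Nakayama argument -/

section ProjectiveDimension

variable {R M N : Type u} [CommRing R] [AddCommGroup M] [Module R M] [AddCommGroup N] [Module R N]

/-- The short exact sequence `0 ⟶ ker f ⟶ M ⟶ N ⟶ 0` of a surjective linear map `f`. -/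
lemma LinearMap.exists_shortExact_ker (f : M →ₗ[R] N) (hf : Function.Surjective f) :
    ∃ S : ShortComplex (ModuleCat.{u} R), S.ShortExact ∧ S.X₁ = ModuleCat.of R (LinearMap.ker f) ∧
      S.X₂ = ModuleCat.of R M ∧ S.X₃ = ModuleCat.of R N := by
  refine ⟨ShortComplex.mk (ModuleCat.ofHom (LinearMap.ker f).subtype) (ModuleCat.ofHom f) ?_,
    ?_, rfl, rfl, rfl⟩
  · ext x
    exact x.2
  · refine ShortComplex.ShortExact.mk' ?_ ?_ ?_
    · rw [ShortComplex.moduleCat_exact_iff]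
      intro x hx
      exact ⟨⟨x, hx⟩, rfl⟩
    · rw [ModuleCat.mono_iff_injective]
      exact Subtype.val_injective
    · rw [ModuleCat.epi_iff_surjective]
      exact hf

lemma LinearMap.hasProjectiveDimensionLT_of_ker [Module.Projective R M] (f : M →ₗ[R] N)
    (hf : Function.Surjective f) {k : ℕ}
    (h : HasProjectiveDimensionLT (ModuleCat.of R (LinearMap.ker f)) k) :
    HasProjectiveDimensionLT (ModuleCat.of R N) (k + 1) := by
  obtain ⟨S, hS, h1, h2, h3⟩ := f.exists_shortExact_ker hf
  rw [← h3]
  rw [← h1] at h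
  refine hS.hasProjectiveDimensionLT_X₃ k h ?_
  have : Projective (ModuleCat.of R M) := (IsProjective.iff_projective M).1 inferInstance
  rw [h2, add_comm]
  infer_instance

/-- The bound starts at `k + 2` because the kernel of a surjection onto a projective module is
projective but need not vanish. -/
lemma LinearMap.hasProjectiveDimensionLT_ker [Module.Projective R M] (f : M →ₗ[R] N)
    (hf : Function.Surjective f) {k : ℕ}
    (h : HasProjectiveDimensionLT (ModuleCat.of R N) (k + 2)) :
    HasProjectiveDimensionLT (ModuleCat.of R (LinearMap.ker f)) (k + 1) := by
  obtain ⟨S, hS, h1, h2, h3⟩ := f.exists_shortExact_ker hf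
  rw [← h3] at h
  rw [← h1]
  refine hS.hasProjectiveDimensionLT_X₁ (k + 1) ?_ h
  have : Projective (ModuleCat.of R M) := (IsProjective.iff_projective M).1 inferInstance
  rw [h2, add_comm]
  infer_instance

/-- A surjection onto a projective module whose kernel lies in `𝔪 M` is injective, if `M` is
finite and torsion-free over a domain and `𝔪` is a proper ideal. -/
lemma LinearMap.ker_eq_bot_of_le_smul_top [IsDomain R] [Module.IsTorsionFree R M]
    [Module.Finite R M] [Module.Projective R N] (f : M →ₗ[R] N) (hf : Function.Surjective f)
    {m : Ideal R} (hm : m ≠ ⊤) (hk : LinearMap.ker f ≤ m • ⊤) : LinearMap.ker f = ⊥ := by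
  obtain ⟨s, hs⟩ := Module.projective_lifting_property f LinearMap.id hf
  have hfs (y : N) : f (s y) = y := LinearMap.congr_fun hs y
  let e : M →ₗ[R] M := LinearMap.id - s ∘ₗ f
  have he (x : M) : e x = x - s (f x) := rfl
  have hrange : LinearMap.range e = LinearMap.ker f := by
    apply le_antisymm
    · rintro _ ⟨x, rfl⟩
      rw [LinearMap.mem_ker, he, map_sub, hfs, sub_self]
    · intro x hx
      exact ⟨x, by rw [he, LinearMap.mem_ker.1 hx, map_zero, sub_zero]⟩
  -- The projection `e` onto the kernel carries `ker f ≤ m • ⊤` to `ker f ≤ m • ker f`.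
  have hle : LinearMap.ker f ≤ m • LinearMap.ker f := by
    intro x hx
    have : e x ∈ (m • (⊤ : Submodule R M)).map e := ⟨x, hk hx, rfl⟩
    rwa [Submodule.map_smul'', Submodule.map_top, hrange, he, LinearMap.mem_ker.1 hx, map_zero,
      sub_zero] at this
  have hfg : (LinearMap.ker f).FG := by
    rw [← hrange, LinearMap.range_eq_map]
    exact Module.Finite.fg_top.map e
  -- Nakayama gives an annihilator of the kernel congruent to `1` modulo `m`. It is nonzero, so
  -- torsion-freeness replaces a local hypothesis on `R`.
  obtain ⟨r, hr, hr0⟩ := Submodule.exists_sub_one_mem_and_smul_eq_zero_of_fg_of_le_smul m _ hfg hle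
  have hrne : r ≠ 0 := by
    rintro rfl
    exact hm ((Ideal.eq_top_iff_one m).2 (by simpa using hr))
  rw [eq_bot_iff]
  intro x hx
  exact (smul_eq_zero.1 (hr0 x hx)).resolve_left hrne

end ProjectiveDimension

/-! ### Projective dimension and `Tor` from a minimal resolution -/

namespace GradedFreeResolution

open Matrix

variable {K : Type u} [Field K] {n : ℕ} {L : Ideal (MvPolynomial (Fin n) K)}

/-- The augmentation, as a map onto `L`. -/
noncomputable def augmentation (F : GradedFreeResolution L) :
    (Fin (F.rank 0) → MvPolynomial (Fin n) K) →ₗ[MvPolynomial (Fin n) K] L :=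
  (Fintype.linearCombination (MvPolynomial (Fin n) K) F.gen).codRestrict L
    (fun v => F.range_gen.le ⟨v, rfl⟩)

lemma augmentation_surjective (F : GradedFreeResolution L) :
    Function.Surjective F.augmentation := by
  rintro ⟨x, hx⟩
  obtain ⟨v, hv⟩ := F.range_gen.ge hx
  exact ⟨v, Subtype.ext hv⟩

lemma ker_augmentation (F : GradedFreeResolution L) :
    LinearMap.ker F.augmentation = F.syzygies 0 :=
  LinearMap.ker_codRestrict _ _ _

/-- The differential, as a map onto the syzygies. -/
noncomputable def toSyzygies (F : GradedFreeResolution L) (i : ℕ) :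
    (Fin (F.rank (i + 1)) → MvPolynomial (Fin n) K) →ₗ[MvPolynomial (Fin n) K] F.syzygies i :=
  (F.diff i).mulVecLin.codRestrict (F.syzygies i) (fun v => F.diff_mulVec_mem i v)

lemma toSyzygies_surjective (F : GradedFreeResolution L) (i : ℕ) :
    Function.Surjective (F.toSyzygies i) := by
  rintro ⟨x, hx⟩
  obtain ⟨v, hv⟩ := (F.range_diff i).ge hx
  exact ⟨v, Subtype.ext hv⟩

lemma ker_toSyzygies (F : GradedFreeResolution L) (i : ℕ) :
    LinearMap.ker (F.toSyzygies i) = F.syzygies (i + 1) :=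
  LinearMap.ker_codRestrict _ _ _

lemma hasProjectiveDimensionLT_of_syzygies (F : GradedFreeResolution L) (k m : ℕ)
    (h : HasProjectiveDimensionLT (ModuleCat.of (MvPolynomial (Fin n) K) (F.syzygies k)) m) :
    HasProjectiveDimensionLT (ModuleCat.of (MvPolynomial (Fin n) K) L) (m + k + 1) := by
  induction k generalizing m with
  | zero =>
    rw [← F.ker_augmentation] at h
    exact LinearMap.hasProjectiveDimensionLT_of_ker _ F.augmentation_surjective h
  | succ k ih =>
    rw [← F.ker_toSyzygies] at h
    have := ih (m + 1) (LinearMap.hasProjectiveDimensionLT_of_ker _ (F.toSyzygies_surjective k) h)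
    rwa [add_right_comm m 1 k] at this

lemma hasProjectiveDimensionLT_syzygies (F : GradedFreeResolution L) (k m : ℕ)
    (h : HasProjectiveDimensionLT (ModuleCat.of (MvPolynomial (Fin n) K) L) (m + k + 2)) :
    HasProjectiveDimensionLT (ModuleCat.of (MvPolynomial (Fin n) K) (F.syzygies k)) (m + 1) := by
  induction k generalizing m with
  | zero =>
    rw [← F.ker_augmentation]
    exact LinearMap.hasProjectiveDimensionLT_ker _ F.augmentation_surjective h
  | succ k ih =>
    rw [← F.ker_toSyzygies]
    refine LinearMap.hasProjectiveDimensionLT_ker _ (F.toSyzygies_surjective k) (ih (m + 1) ?_)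
    rwa [add_right_comm m 1 k]

theorem hasProjectiveDimensionLE_of_rank_eq_zero (F : GradedFreeResolution L) {k : ℕ}
    (hk : F.rank (k + 1) = 0) :
    HasProjectiveDimensionLE (ModuleCat.of (MvPolynomial (Fin n) K) L) k := by
  have hz : F.syzygies k = ⊥ := by
    rw [← F.range_diff, LinearMap.range_eq_bot]
    have : IsEmpty (Fin (F.rank (k + 1))) := by rw [hk]; infer_instance
    exact Subsingleton.elim _ _
  have := F.hasProjectiveDimensionLT_of_syzygies k 0
    (ModuleCat.isZero_of_iff_subsingleton.2 (by rw [hz]; infer_instance)).hasProjectiveDimensionLT_zero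
  rwa [zero_add] at this

/-- A resolution is minimal if the entries of its differentials have no constant term. -/
def IsMinimal (F : GradedFreeResolution L) : Prop :=
  ∀ i c b, constantCoeff (F.diff i c b) = 0

lemma IsMinimal.syzygies_le {F : GradedFreeResolution L} (hF : F.IsMinimal) (i : ℕ) :
    F.syzygies i ≤ RingHom.ker (constantCoeff (R := K) (σ := Fin n)) • ⊤ := by
  rw [← F.range_diff]
  rintro _ ⟨v, rfl⟩
  rw [pi_eq_sum_univ ((F.diff i).mulVecLin v)]
  refine Submodule.sum_mem _ fun c _ => Submodule.smul_mem_smul ?_ trivial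
  rw [RingHom.mem_ker, mulVecLin_apply, mulVec, dotProduct, map_sum]
  exact Finset.sum_eq_zero fun b _ => by rw [map_mul, hF, zero_mul]

/-- The map out of position `k` has projective image (`L` itself if `k = 0`) and its kernel lies in
`𝔪` times the free module, so it is injective. Then the next differential is zero, and position `k +
1` consists of boundaries, all with coordinates in `𝔪`; a basis vector is not of this kind. -/
theorem IsMinimal.rank_eq_zero {F : GradedFreeResolution L} (hF : F.IsMinimal) {k : ℕ}
    (hL : HasProjectiveDimensionLE (ModuleCat.of (MvPolynomial (Fin n) K) L) k) :
    F.rank (k + 1) = 0 := by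
  have hm : RingHom.ker (constantCoeff (R := K) (σ := Fin n)) ≠ ⊤ := RingHom.ker_ne_top _
  have hz : F.syzygies k = ⊥ := by
    cases k with
    | zero =>
      have : Module.Projective (MvPolynomial (Fin n) K) L :=
        (IsProjective.iff_projective _).2 ((projective_iff_hasProjectiveDimensionLE_zero _).2 hL)
      rw [← F.ker_augmentation]
      refine LinearMap.ker_eq_bot_of_le_smul_top _ F.augmentation_surjective hm ?_
      rw [F.ker_augmentation]
      exact hF.syzygies_le 0
    | succ k =>
      have : HasProjectiveDimensionLT
          (ModuleCat.of (MvPolynomial (Fin n) K) (F.syzygies k)) (0 + 1) :=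
        F.hasProjectiveDimensionLT_syzygies k 0 (by rw [zero_add]; exact hL)
      have : Module.Projective (MvPolynomial (Fin n) K) (F.syzygies k) :=
        (IsProjective.iff_projective _).2 (projective_iff_hasProjectiveDimensionLT_one.2 this)
      rw [← F.ker_toSyzygies]
      refine LinearMap.ker_eq_bot_of_le_smul_top _ (F.toSyzygies_surjective k) hm ?_
      rw [F.ker_toSyzygies]
      exact hF.syzygies_le (k + 1)
  have htop : F.syzygies (k + 1) = ⊤ := by
    rw [← F.range_diff, LinearMap.range_eq_bot] at hz
    rw [syzygies, hz, LinearMap.ker_zero]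
  by_contra h0
  let b : Fin (F.rank (k + 1)) := ⟨0, Nat.pos_of_ne_zero h0⟩
  have hb : Pi.single b 1 ∈ F.syzygies (k + 1) := by rw [htop]; trivial
  rw [← F.range_diff] at hb
  obtain ⟨v, hv⟩ := hb
  have h1 := congrArg constantCoeff (congrFun hv b)
  rw [mulVecLin_apply, mulVec, dotProduct, map_sum, Pi.single_eq_same, map_one,
    Finset.sum_eq_zero fun c _ => by rw [map_mul, hF, zero_mul]] at h1
  exact zero_ne_one h1

/-- The basis elements of a minimal resolution give nonzero classes in `Tor`. -/
theorem IsMinimal.torNonzero {F : GradedFreeResolution L} (hF : F.IsMinimal) (i : ℕ)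
    (b : Fin (F.rank i)) : TorNonzero L i (F.deg i b) := by
  have hz (i : ℕ) : F.diffK i = 0 := by
    have : (F.diff i).map (constantCoeff (R := K) (σ := Fin n)) = 0 := by
      ext c b
      exact hF i c b
    rw [diffK, this]
    exact Matrix.mulVecLin_zero
  refine ⟨F, ?_⟩
  rw [Submodule.Quotient.nontrivial_iff, Ne, Submodule.comap_subtype_eq_top]
  intro h
  have hb : Pi.single b 1 ∈ F.degreePart i (F.deg i b) := fun c hc =>
    Pi.single_eq_of_ne (by rintro rfl; exact hc rfl) _
  have hc : Pi.single b 1 ∈ F.cycles i (F.deg i b) := by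
    cases i with
    | zero => exact hb
    | succ i => exact ⟨hb, by rw [hz]; rfl⟩
  obtain ⟨v, -, hv⟩ := h hc
  rw [hz] at hv
  have := congrFun hv b
  simp at this

end GradedFreeResolution

/-! ### Minimal generators of a filtered vector space -/

section FilteredVectorSpace

variable {K V : Type*} {P : Type} [Field K] [AddCommGroup V] [Module K V] [SemilatticeInf P]

/-- The span of the part of a filtration that comes strictly before `c`. -/
def strictPart (Z : P → Submodule K V) (c : P) : Submodule K V := ⨆ c' : {c' // c' < c}, Z c'

/-- A basis of `W` is a set of new generators needed at `c`. -/
lemma exists_disjoint_strictPart {Z : P → Submodule K V} (hZ : Monotone Z) (c : P) :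
    ∃ W : Submodule K V, Disjoint W (strictPart Z c) ∧ W ⊔ strictPart Z c = Z c := by
  obtain ⟨Q, hQ⟩ := Submodule.exists_isCompl (strictPart Z c)
  have hle : strictPart Z c ≤ Z c := iSup_le fun c' => hZ c'.2.le
  refine ⟨Q ⊓ Z c, hQ.disjoint.symm.mono_left inf_le_left, ?_⟩
  rw [sup_comm, ← sup_inf_assoc_of_le Q hle, hQ.sup_eq_top, top_inf_eq]

/-- A filtration of a finite-dimensional vector space by an ordered set, all of whose jumps occur
below `M`, has a finite minimal system of generators. -/
lemma exists_minimal_generators [FiniteDimensional K V] [LocallyFiniteOrderBot P] [WellFoundedLT P]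
    {Z : P → Submodule K V} (hZ : Monotone Z) (M : P) (hM : ∀ c, Z c ≤ Z (c ⊓ M)) :
    ∃ (γ : Type) (_ : Fintype γ) (lab : γ → P) (w : γ → V), (∀ g, lab g ≤ M) ∧
      (∀ g, w g ∈ Z (lab g)) ∧
      (∀ c, ∀ z ∈ Z c, ∃ x : γ → K, (∀ g, x g ≠ 0 → lab g ≤ c) ∧ ∑ g, x g • w g = z) ∧
      ∀ c (x : γ → K), (∀ g, x g ≠ 0 → lab g ≤ c) → ∑ g, x g • w g = 0 →
        ∀ g, lab g = c → x g = 0 := by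
  classical
  choose W hW hWZ using exists_disjoint_strictPart hZ
  have hWle (c) : W c ≤ Z c := le_sup_left.trans (hWZ c).le
  have hstrict {c' c : P} (h : c' < c) : Z c' ≤ strictPart Z c :=
    le_iSup (fun c' : {c' // c' < c} => Z c') ⟨c', h⟩
  let β (c : P) := Module.finBasis K (W c)
  let γ := Σ c : Finset.Iic M, Fin (Module.finrank K (W c))
  let w : γ → V := fun g => (β g.1 g.2 : V)
  let T (c : P) : Submodule K V := Submodule.span K (w '' {g | g.1.1 ≤ c})
  have hT : Monotone T := fun c c' h =>
    Submodule.span_mono (Set.image_mono fun g hg => le_trans hg h)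
  have hZT (c : P) : Z c ≤ T c := by
    induction c using WellFoundedLT.induction with
    | ind c ih =>
    by_cases hc : c ≤ M
    · rw [← hWZ]
      refine sup_le ?_ (iSup_le fun c' => (ih c'.1 c'.2).trans (hT c'.2.le))
      have : W c = Submodule.span K (Set.range fun k => (β c k : V)) := by
        have h := congrArg (Submodule.map (W c).subtype) (β c).span_eq
        rw [Submodule.map_span, Submodule.map_top, Submodule.range_subtype, ← Set.range_comp] at h
        exact h.symm
      rw [this, Submodule.span_le]
      rintro _ ⟨k, rfl⟩
      exact Submodule.subset_span ⟨⟨⟨c, Finset.mem_Iic.2 hc⟩, k⟩, le_refl c, rfl⟩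
    · have hlt : c ⊓ M < c := lt_of_le_of_ne inf_le_left fun h => hc (inf_eq_left.1 h)
      exact (hM c).trans ((ih _ hlt).trans (hT hlt.le))
  refine ⟨γ, inferInstance, fun g => g.1.1, w, fun g => Finset.mem_Iic.1 g.1.2,
    fun g => hWle _ (β g.1 g.2).2, fun c z hz => ?_, ?_⟩
  · obtain ⟨l, hl, rfl⟩ := (Finsupp.mem_span_image_iff_linearCombination K).1 (hZT c hz)
    refine ⟨l, fun g hg => hl (Finsupp.mem_support_iff.2 hg), ?_⟩
    rw [Finsupp.linearCombination_apply, Finsupp.sum_fintype _ _ (by simp)]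
  · rintro _ x hx h0 ⟨c, k⟩ rfl
    dsimp only at hx
    -- Isolate the generators labelled `c`. The others lie in the strict part, which meets `W c`
    -- trivially, so the isolated sum vanishes.
    rw [Fintype.sum_sigma, ← Finset.add_sum_erase _ _ (Finset.mem_univ c)] at h0
    have h1 : ∑ k, x ⟨c, k⟩ • w ⟨c, k⟩ ∈ W c :=
      Submodule.sum_mem _ fun k _ => Submodule.smul_mem _ _ (β c k).2
    have h2 : ∑ c' ∈ Finset.univ.erase c, ∑ k, x ⟨c', k⟩ • w ⟨c', k⟩ ∈ strictPart Z c := by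
      refine Submodule.sum_mem _ fun c' hc' => Submodule.sum_mem _ fun k _ => ?_
      by_cases h : x ⟨c', k⟩ = 0
      · rw [h, zero_smul]
        exact Submodule.zero_mem _
      · refine Submodule.smul_mem _ _ (hstrict (lt_of_le_of_ne (hx _ h) fun h => ?_)
          (hWle _ (β c' k).2))
        exact Finset.ne_of_mem_erase hc' (Subtype.ext h)
    have h3 : ∑ k, x ⟨c, k⟩ • w ⟨c, k⟩ = 0 := by
      refine Submodule.disjoint_def.1 (hW c) _ h1 ?_
      rw [eq_neg_of_add_eq_zero_left h0]
      exact Submodule.neg_mem _ h2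
    refine Fintype.linearIndependent_iff.1 (β c).linearIndependent (fun k => x ⟨c, k⟩) ?_ k
    apply Subtype.ext
    rw [Submodule.coe_sum]
    exact h3

end FilteredVectorSpace

/-! ### Labelled complexes and the minimal resolution -/

open Matrix

/-- A finite complex of free `K`-modules with a basis `ι`, whose basis elements have a homological
position and a multidegree; the differential has position `-1`, and does not increase the
multidegree. -/
structure LabeledComplex (K : Type u) [Field K] (n : ℕ) (ι : Type) [Fintype ι] where
  d : Matrix ι ι K
  pos : ι → ℕ
  lab : ι → (Fin n →₀ ℕ)
  d_pos : ∀ i j, d i j ≠ 0 → pos j = pos i + 1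
  d_lab : ∀ i j, d i j ≠ 0 → lab i ≤ lab j
  d_sq : d * d = 0

namespace LabeledComplex

variable {K : Type u} [Field K] {n : ℕ} {ι : Type} [Fintype ι]

/-- The subcomplex spanned by the basis elements with label at most `c`. -/
def part (C : LabeledComplex K n ι) (c : Fin n →₀ ℕ) : Submodule K (ι → K) where
  carrier := {v | ∀ b, v b ≠ 0 → C.lab b ≤ c}
  add_mem' {v w} hv hw b hb := by
    by_contra h
    have h1 := not_imp_not.2 (hv b) h
    have h2 := not_imp_not.2 (hw b) h
    rw [not_not] at h1 h2
    simp [h1, h2] at hb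
  zero_mem' b hb := absurd rfl hb
  smul_mem' a v hv b hb := hv b (right_ne_zero_of_mul hb)

lemma d_mulVec_mem (C : LabeledComplex K n ι) {c : Fin n →₀ ℕ} {v : ι → K} (hv : v ∈ C.part c) :
    C.d *ᵥ v ∈ C.part c := by
  intro i hi
  obtain ⟨j, -, hj⟩ := Finset.exists_ne_zero_of_sum_ne_zero hi
  exact (C.d_lab i j (left_ne_zero_of_mul hj)).trans (hv j (right_ne_zero_of_mul hj))

/-- The component of a cycle at a position is a cycle. -/
lemma d_mulVec_ite (C : LabeledComplex K n ι) {v : ι → K} (hv : C.d *ᵥ v = 0) (k : ℕ) :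
    C.d *ᵥ (fun b => if C.pos b = k then v b else 0) = 0 := by
  funext i
  rw [mulVec, dotProduct, Pi.zero_apply]
  by_cases hk : C.pos i + 1 = k
  · rw [← Pi.zero_apply (M := fun _ : ι => K) i, ← hv, mulVec, dotProduct]
    refine Finset.sum_congr rfl fun j _ => ?_
    by_cases h : C.d i j = 0
    · rw [h, zero_mul, zero_mul]
    · rw [if_pos (by rw [C.d_pos i j h, hk])]
  · refine Finset.sum_eq_zero fun j _ => ?_
    by_cases h : C.d i j = 0
    · rw [h, zero_mul]
    · rw [if_neg (by rwa [C.d_pos i j h]), mul_zero]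

/-- The complex resolves `S ⧸ I`, where the monomials in `I` are those with exponent in `U`,
in the positions below `k`. -/
structure IsResolutionBelow (C : LabeledComplex K n ι) (U : Set (Fin n →₀ ℕ)) (o : ι)
    (k : ℕ∞) : Prop where
  pos_eq_zero : ∀ b, C.pos b = 0 ↔ b = o
  lab_base : C.lab o = 0
  lab_mem : ∀ b, b ≠ o → C.lab b ∈ U
  exact : ∀ c ∈ U, ∀ v ∈ C.part c, (∀ b, v b ≠ 0 → (C.pos b : ℕ∞) < k) → C.d *ᵥ v = 0 →
    ∃ w ∈ C.part c, C.d *ᵥ w = v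

/-- The complex resolves `S ⧸ I`, where the monomials in `I` are those with exponent in `U`. -/
abbrev IsResolution (C : LabeledComplex K n ι) (U : Set (Fin n →₀ ℕ)) (o : ι) : Prop :=
  C.IsResolutionBelow U o ⊤

/-- The cycles in position `k` of the part of the complex with labels at most `c`,
for `c ∈ U`. -/
def cyclesAt (C : LabeledComplex K n ι) (U : Set (Fin n →₀ ℕ)) (k : ℕ) (c : Fin n →₀ ℕ) :
    Submodule K (ι → K) where
  carrier := {v | (∀ b, v b ≠ 0 → C.lab b ≤ c ∧ C.pos b = k ∧ c ∈ U) ∧ C.d *ᵥ v = 0}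
  add_mem' {v w} hv hw := by
    refine ⟨fun b hb => ?_, by rw [mulVec_add, hv.2, hw.2, add_zero]⟩
    by_contra h
    have h1 := not_imp_not.2 (hv.1 b) h
    have h2 := not_imp_not.2 (hw.1 b) h
    rw [not_not] at h1 h2
    simp [h1, h2] at hb
  zero_mem' := ⟨fun b hb => absurd rfl hb, mulVec_zero _⟩
  smul_mem' a v hv :=
    ⟨fun b hb => hv.1 b (right_ne_zero_of_mul hb), by rw [mulVec_smul, hv.2, smul_zero]⟩

/-- New basis elements in position `k + 1`, with a column of the differential for each. -/
def extend (C : LabeledComplex K n ι) {U : Set (Fin n →₀ ℕ)} {k : ℕ} {γ : Type} [Fintype γ]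
    (lab : γ → (Fin n →₀ ℕ)) (w : γ → ι → K) (hw : ∀ g, w g ∈ C.cyclesAt U k (lab g)) :
    LabeledComplex K n (ι ⊕ γ) where
  d := fromBlocks C.d (of fun i g => w g i) 0 0
  pos := Sum.elim C.pos fun _ => k + 1
  lab := Sum.elim C.lab lab
  d_pos := by
    rintro (i | g) (j | g') h
    · exact C.d_pos i j h
    · exact congrArg (· + 1) ((hw g').1 i h).2.1.symm
    · exact absurd rfl h
    · exact absurd rfl h
  d_lab := by
    rintro (i | g) (j | g') h
    · exact C.d_lab i j h
    · exact ((hw g').1 i h).1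
    · exact absurd rfl h
    · exact absurd rfl h
  d_sq := by
    have h : C.d * of (fun i g => w g i) = 0 := by
      ext i g
      exact congrFun (hw g).2 i
    rw [fromBlocks_multiply, C.d_sq, h]
    simp

lemma extend_d_mulVec (C : LabeledComplex K n ι) {U : Set (Fin n →₀ ℕ)} {k : ℕ} {γ : Type}
    [Fintype γ] (lab : γ → (Fin n →₀ ℕ)) (w : γ → ι → K)
    (hw : ∀ g, w g ∈ C.cyclesAt U k (lab g)) (v : ι → K) (x : γ → K) :
    (C.extend lab w hw).d *ᵥ Sum.elim v x = Sum.elim (C.d *ᵥ v + ∑ g, x g • w g) 0 := by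
  have : (of fun i g => w g i) *ᵥ x = ∑ g, x g • w g := by
    funext i
    simp [mulVec, dotProduct, mul_comm]
  rw [extend, fromBlocks_mulVec]
  simp [this]

/-- The differential does not map a basis element in a position greater than `1` to a combination
that involves basis elements with the same label. -/
def IsMinimal (C : LabeledComplex K n ι) (o : ι) : Prop :=
  ∀ i j, C.d i j ≠ 0 → i ≠ o → C.lab i < C.lab j

lemma degree_lt_degree {a b : Fin n →₀ ℕ} (h : a < b) : a.degree < b.degree := by
  obtain ⟨c, rfl⟩ := exists_add_of_le h.le
  have : c ≠ 0 := by
    rintro rfl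
    simp at h
  rw [map_add]
  have := (Finsupp.degree_eq_zero_iff c).not.2 this
  omega

/-- Each step kills the cycles in position `k` by minimal generators placed in position `k + 1`. The
last clause, that cycles in the top position avoid basis elements of their own label, makes the next
step minimal. The bound of the position by the degree of the label makes the process terminate. -/
lemma exists_isResolutionBelow (K : Type u) [Field K] {U : Set (Fin n →₀ ℕ)} (hU : IsUpperSet U)
    {M : Fin n →₀ ℕ} (hM : ∀ c ∈ U, c ⊓ M ∈ U) (k : ℕ) :
    ∃ (ι : Type) (_ : Fintype ι) (C : LabeledComplex K n ι) (o : ι), C.IsResolutionBelow U o k ∧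
      C.IsMinimal o ∧ (∀ b, C.lab b ≤ M) ∧ (∀ b, C.pos b ≤ k) ∧
      (∀ b, C.pos b ≤ (C.lab b).degree + 1) ∧
      ∀ c, ∀ v : ι → K, (∀ b, v b ≠ 0 → C.lab b ≤ c ∧ C.pos b = k) → C.d *ᵥ v = 0 →
        ∀ i, i ≠ o → C.lab i = c → v i = 0 := by
  classical
  induction k with
  | zero =>
    refine ⟨Unit, inferInstance, ⟨0, fun _ => 0, fun _ => 0, fun _ _ h => absurd rfl h,
      fun _ _ h => absurd rfl h, zero_mul 0⟩, (), ⟨?_, rfl, ?_, ?_⟩, ?_, ?_, ?_, ?_, ?_⟩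
    · simp
    · simp
    · intro c _ v _ hv _
      refine ⟨0, Submodule.zero_mem _, ?_⟩
      rw [mulVec_zero]
      funext b
      by_contra h
      exact absurd (hv b (Ne.symm h)) (by simp)
    · exact fun _ _ h => absurd rfl h
    · simp
    · simp
    · simp
    · exact fun _ _ _ _ i hi => absurd rfl hi
  | succ k ih =>
    obtain ⟨ι, _, C, o, hC, hmin, hlabM, hpos, hdeg, hker⟩ := ih
    -- The cycles are filtered by multidegree because `U` is an upper set. As all labels so far are
    -- at most `M`, nothing new appears outside the interval below `M`.
    obtain ⟨γ, _, lab, w, hlab, hw, hspan, hindep⟩ :=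
      exists_minimal_generators (Z := C.cyclesAt U k)
        (fun c c' hc v hv =>
          ⟨fun b hb => ⟨(hv.1 b hb).1.trans hc, (hv.1 b hb).2.1, hU hc (hv.1 b hb).2.2⟩, hv.2⟩)
        M (fun c v hv => ⟨fun b hb => ⟨le_inf (hv.1 b hb).1 (hlabM b), (hv.1 b hb).2.1,
          hM c (hv.1 b hb).2.2⟩, hv.2⟩)
    -- A minimal generator is nonzero, and any nonzero coordinate witnesses that its label is in
    -- `U`.
    have hne (g : γ) : ∃ i, w g i ≠ 0 := by
      by_contra! h
      have h0 : w g = 0 := funext h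
      have := hindep (lab g) (Pi.single g 1) (fun g' hg' => by
        by_cases h : g' = g
        · rw [h]
        · exact absurd (Pi.single_eq_of_ne h _) hg') (by
        rw [Finset.sum_eq_single g (fun g' _ h => by rw [Pi.single_eq_of_ne h, zero_smul])
          (by simp), h0, smul_zero]) g rfl
      simp at this
    have hlt (g : γ) (i : ι) (hi : i ≠ o) (h : w g i ≠ 0) : C.lab i < lab g := by
      refine lt_of_le_of_ne ((hw g).1 i h).1 fun heq => h ?_
      exact hker _ (w g) (fun b hb => ⟨((hw g).1 b hb).1, ((hw g).1 b hb).2.1⟩) (hw g).2 i hi heq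
    refine ⟨ι ⊕ γ, inferInstance, C.extend lab w hw, Sum.inl o, ⟨?_, hC.lab_base, ?_, ?_⟩,
      ?_, ?_, ?_, ?_, ?_⟩
    · rintro (b | g)
      · simpa [extend] using hC.pos_eq_zero b
      · simp [extend]
    · rintro (b | g) h
      · exact hC.lab_mem b fun h' => h (by rw [h'])
      · obtain ⟨i, hi⟩ := hne g
        exact ((hw g).1 i hi).2.2
    · intro c hc v hv hvk hdv
      obtain ⟨v, y, rfl⟩ : ∃ v' y, v = Sum.elim v' y :=
        ⟨v ∘ Sum.inl, v ∘ Sum.inr, (Sum.elim_comp_inl_inr v).symm⟩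
      have hy : y = 0 := by
        funext g
        by_contra h
        exact absurd (hvk (Sum.inr g) h) (lt_irrefl _)
      subst hy
      have hdv' : C.d *ᵥ v = 0 := by
        rw [extend_d_mulVec] at hdv
        simpa using congrArg (· ∘ Sum.inl) hdv
      -- The component in position `k` is bounded by the new generators, the remainder by the old
      -- complex.
      set v2 : ι → K := fun b => if C.pos b = k then v b else 0 with hv2
      have hd2 : C.d *ᵥ v2 = 0 := C.d_mulVec_ite hdv' k
      have hmem : v ∈ C.part c := fun b hb => hv (Sum.inl b) hb
      have hmem2 : v2 ∈ C.part c := fun b hb => hmem b fun h => hb (by simp [hv2, h])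
      obtain ⟨w1, hw1, hdw1⟩ := hC.exact c hc (v - v2) (Submodule.sub_mem _ hmem hmem2)
        (fun b hb => by
          have h1 : C.pos b ≠ k := fun h => hb (by simp [hv2, h])
          have h2 := hpos b
          exact_mod_cast lt_of_le_of_ne h2 h1)
        (by rw [mulVec_sub, hdv', hd2, sub_zero])
      obtain ⟨x, hx, hxv⟩ := hspan c v2 ⟨fun b hb => ⟨hmem2 b hb, by
        by_contra h
        exact hb (if_neg h), hc⟩, hd2⟩
      refine ⟨Sum.elim w1 x, ?_, ?_⟩
      · rintro (b | g) h
        · exact hw1 b h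
        · exact hx g h
      · rw [extend_d_mulVec, hdw1, hxv, sub_add_cancel]
    · rintro (i | g) (j | g') h hi
      · exact hmin i j h fun h' => hi (by rw [h'])
      · exact hlt g' i (fun h' => hi (by rw [h'])) h
      · exact absurd rfl h
      · exact absurd rfl h
    · rintro (b | g)
      · exact hlabM b
      · exact hlab g
    · rintro (b | g)
      · exact (hpos b).trans (Nat.le_succ k)
      · exact le_refl (k + 1)
    · rintro (b | g)
      · exact hdeg b
      · change k + 1 ≤ (lab g).degree + 1
        obtain ⟨i, hi⟩ := hne g
        have hik := ((hw g).1 i hi).2.1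
        -- A generator that involves `o` has `k = 0`; otherwise its label is strictly above that of
        -- an element in position `k`, so the degree rises.
        by_cases hio : i = o
        · have := (hC.pos_eq_zero i).2 hio
          omega
        · have := degree_lt_degree (hlt g i hio hi)
          have := hdeg i
          omega
    · intro c v hv hdv
      obtain ⟨v, y, rfl⟩ : ∃ v' y, v = Sum.elim v' y :=
        ⟨v ∘ Sum.inl, v ∘ Sum.inr, (Sum.elim_comp_inl_inr v).symm⟩
      have hv0 : v = 0 := by
        funext b
        by_contra h
        have h1 : C.pos b = k + 1 := (hv (Sum.inl b) h).2
        have h2 := hpos b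
        omega
      subst hv0
      rintro (i | g) hi hic
      · rfl
      · refine hindep c y (fun g hg => (hv (Sum.inr g) hg).1) ?_ g hic
        rw [extend_d_mulVec] at hdv
        simpa using congrArg (· ∘ Sum.inl) hdv

/-- The minimal resolution, all of whose labels are at most `M` if the intersection with the
interval below `M` determines `U`. -/
theorem exists_isMinimal_isResolution (K : Type u) [Field K] {U : Set (Fin n →₀ ℕ)}
    (hU : IsUpperSet U) {M : Fin n →₀ ℕ} (hM : ∀ c ∈ U, c ⊓ M ∈ U) :
    ∃ (ι : Type) (_ : Fintype ι) (C : LabeledComplex K n ι) (o : ι), C.IsResolution U o ∧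
      C.IsMinimal o ∧ ∀ b, C.lab b ≤ M := by
  obtain ⟨ι, _, C, o, hC, hmin, hlabM, -, hdeg, -⟩ :=
    exists_isResolutionBelow K hU hM (M.degree + 2)
  -- No position exceeds `M.degree + 1`, so exactness below `M.degree + 2` is exactness everywhere.
  refine ⟨ι, inferInstance, C, o, ⟨hC.pos_eq_zero, hC.lab_base, hC.lab_mem, ?_⟩, hmin, hlabM⟩
  intro c hc v hv _ hdv
  refine hC.exact c hc v hv (fun b _ => ?_) hdv
  have h1 := hdeg b
  have h2 : (C.lab b).degree ≤ M.degree := Finsupp.degree_mono (hlabM b)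
  exact_mod_cast (by omega : C.pos b < M.degree + 2)

end LabeledComplex

/-! ### Contracting homotopies and the product complex -/

namespace LabeledComplex

variable {K : Type u} [Field K] {n : ℕ} {ι κ : Type} [Fintype ι] [Fintype κ]

/-- The part of the complex with labels at most `c` has a contracting homotopy. -/
def IsContractible [DecidableEq ι] (C : LabeledComplex K n ι) (c : Fin n →₀ ℕ) : Prop :=
  ∃ s : Matrix ι ι K, (∀ i j, s i j ≠ 0 → C.pos i = C.pos j + 1) ∧
    (∀ i j, s i j ≠ 0 → C.lab j ≤ c → C.lab i ≤ c) ∧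
    ∀ i j, C.lab j ≤ c → (C.d * s + s * C.d) i j = (1 : Matrix ι ι K) i j

lemma IsContractible.exact [DecidableEq ι] {C : LabeledComplex K n ι} {c : Fin n →₀ ℕ}
    (hC : C.IsContractible c) {v : ι → K} (hv : v ∈ C.part c) (hd : C.d *ᵥ v = 0) :
    ∃ w ∈ C.part c, C.d *ᵥ w = v := by
  obtain ⟨s, -, hs, h⟩ := hC
  refine ⟨s *ᵥ v, fun i hi => ?_, ?_⟩
  · obtain ⟨j, -, hj⟩ := Finset.exists_ne_zero_of_sum_ne_zero hi
    exact hs i j (left_ne_zero_of_mul hj) (hv j (right_ne_zero_of_mul hj))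
  · have h1 : (C.d * s + s * C.d) *ᵥ v = (1 : Matrix ι ι K) *ᵥ v := by
      funext i
      rw [mulVec, mulVec, dotProduct, dotProduct]
      refine Finset.sum_congr rfl fun j _ => ?_
      by_cases hj : v j = 0
      · rw [hj, mul_zero, mul_zero]
      · rw [h i j (hv j hj)]
    rwa [add_mulVec, ← mulVec_mulVec, ← mulVec_mulVec, hd, mulVec_zero, add_zero,
      one_mulVec] at h1

/-- For a section `σ` of `δ` onto its range, `v - σ (δ v)` is a cycle, hence in the range; `s`
applies `σ` to it. -/
lemma _root_.LinearMap.exists_contraction {V : Type*} [AddCommGroup V] [Module K V]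
    (δ : V →ₗ[K] V) (h : LinearMap.ker δ = LinearMap.range δ) :
    ∃ s : V →ₗ[K] V, ∀ v, δ (s v) + s (δ v) = v := by
  obtain ⟨σ, hσ⟩ := δ.rangeRestrict.exists_rightInverse_of_surjective δ.range_rangeRestrict
  have hσ' (y : LinearMap.range δ) : δ (σ y) = y := congrArg Subtype.val (LinearMap.congr_fun hσ y)
  have hmem (v : V) : v - σ (δ.rangeRestrict v) ∈ LinearMap.range δ := by
    refine h.le ?_
    rw [LinearMap.mem_ker, map_sub, hσ']
    exact sub_self _
  let p : V →ₗ[K] LinearMap.range δ :=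
    (LinearMap.id - σ ∘ₗ δ.rangeRestrict).codRestrict (LinearMap.range δ) hmem
  refine ⟨σ ∘ₗ p, fun v => ?_⟩
  have hδ : δ (δ v) = 0 := by
    rw [← LinearMap.mem_ker, h]
    exact ⟨v, rfl⟩
  have hp : p (δ v) = δ.rangeRestrict v := by
    apply Subtype.ext
    change δ v - σ (δ.rangeRestrict (δ v)) = δ v
    have : δ.rangeRestrict (δ v) = 0 := Subtype.ext hδ
    rw [this, map_zero, sub_zero]
  rw [LinearMap.comp_apply, LinearMap.comp_apply, hσ', hp]
  exact sub_add_cancel v _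

/-- Exactness is turned into a homotopy because a homotopy passes directly to tensor products. -/
lemma isContractible_of_exact [DecidableEq ι] (C : LabeledComplex K n ι) (c : Fin n →₀ ℕ)
    (h : ∀ v ∈ C.part c, C.d *ᵥ v = 0 → ∃ w ∈ C.part c, C.d *ᵥ w = v) :
    C.IsContractible c := by
  classical
  let δ : C.part c →ₗ[K] C.part c :=
    C.d.mulVecLin.restrict (fun v hv => C.d_mulVec_mem hv)
  have hδ : LinearMap.ker δ = LinearMap.range δ := by
    ext v
    constructor
    · intro hv
      obtain ⟨w, hw, hwv⟩ := h v v.2 (congrArg Subtype.val hv)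
      exact ⟨⟨w, hw⟩, Subtype.ext hwv⟩
    · rintro ⟨w, rfl⟩
      apply Subtype.ext
      change C.d *ᵥ (C.d *ᵥ w.1) = 0
      rw [mulVec_mulVec, C.d_sq, zero_mulVec]
  obtain ⟨s, hs⟩ := δ.exists_contraction hδ
  have he {j : ι} (hj : C.lab j ≤ c) : Pi.single j (1 : K) ∈ C.part c := by
    intro b hb
    by_cases h : b = j
    · rwa [h]
    · exact absurd (Pi.single_eq_of_ne h _) hb
  let t : Matrix ι ι K := of fun i j => if hj : C.lab j ≤ c then (s ⟨_, he hj⟩).1 i else 0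
  have htv (v : ι → K) (hv : v ∈ C.part c) : t *ᵥ v = (s ⟨v, hv⟩).1 := by
    have hsum : (⟨v, hv⟩ : C.part c) =
        ∑ j, v j • if hj : C.lab j ≤ c then (⟨_, he hj⟩ : C.part c) else 0 := by
      apply Subtype.ext
      rw [Submodule.coe_sum]
      refine (pi_eq_sum_univ' v).trans ?_
      refine Finset.sum_congr rfl fun j _ => ?_
      by_cases hj : v j = 0
      · simp [hj]
      · rw [dif_pos (hv j hj)]
        funext i
        simp [Pi.single_apply, eq_comm]
    rw [hsum, map_sum, Submodule.coe_sum]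
    funext i
    rw [Finset.sum_apply, mulVec, dotProduct]
    refine Finset.sum_congr rfl fun j _ => ?_
    rw [map_smul]
    by_cases hj : C.lab j ≤ c
    · have htj : t i j = (s ⟨_, he hj⟩).1 i := dif_pos hj
      rw [dif_pos hj, htj, mul_comm]
      rfl
    · have htj : t i j = 0 := dif_neg hj
      rw [dif_neg hj, htj, map_zero, zero_mul, smul_zero]
      rfl
  have ht (j : ι) (hj : C.lab j ≤ c) (i : ι) :
      (C.d * t + t * C.d) i j = (1 : Matrix ι ι K) i j := by
    have h1 := congrArg Subtype.val (hs ⟨_, he hj⟩)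
    have h2 : C.d *ᵥ (t *ᵥ Pi.single j 1) + t *ᵥ (C.d *ᵥ Pi.single j 1) = Pi.single j 1 := by
      rw [htv _ (he hj), htv _ (C.d_mulVec_mem (he hj))]
      exact h1
    rw [mulVec_mulVec, mulVec_mulVec, ← add_mulVec, mulVec_single_one] at h2
    have := congrFun h2 i
    rw [Matrix.one_apply, ← Pi.single_apply]
    exact this
  -- Only entries raising the position by one contribute to `d t + t d` between elements of equal
  -- position. Between different positions the truncated sum and the identity both vanish.
  refine ⟨of fun i j => if C.pos i = C.pos j + 1 then t i j else 0, fun i j hij => ?_,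
    fun i j hij hj => ?_, fun i j hj => ?_⟩
  · by_contra h
    exact hij (if_neg h)
  · have hij' : t i j ≠ 0 := fun h => hij (by simp [h])
    rw [show t i j = (s ⟨_, he hj⟩).1 i from dif_pos hj] at hij'
    exact (s ⟨_, he hj⟩).2 i hij'
  · by_cases hp : C.pos i = C.pos j
    · rw [← ht j hj i, Matrix.add_apply, Matrix.add_apply, Matrix.mul_apply, Matrix.mul_apply,
        Matrix.mul_apply, Matrix.mul_apply]
      congr 1
      · refine Finset.sum_congr rfl fun x _ => ?_
        by_cases hx : C.d i x = 0
        · rw [hx, zero_mul, zero_mul]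
        · rw [of_apply, if_pos (by rw [C.d_pos i x hx, hp])]
      · refine Finset.sum_congr rfl fun x _ => ?_
        by_cases hx : C.d x j = 0
        · rw [hx, mul_zero, mul_zero]
        · rw [of_apply, if_pos (by rw [hp, C.d_pos x j hx])]
    · rw [Matrix.one_apply_ne (fun h => hp (by rw [h])), Matrix.add_apply, Matrix.mul_apply,
        Matrix.mul_apply, Finset.sum_eq_zero, Finset.sum_eq_zero, add_zero]
      · intro x _
        by_cases hx : C.d x j = 0
        · rw [hx, mul_zero]
        · rw [of_apply, if_neg (by rw [← C.d_pos x j hx]; exact hp), zero_mul]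
      · intro x _
        by_cases hx : C.d i x = 0
        · rw [hx, zero_mul]
        · rw [of_apply, if_neg (by rw [C.d_pos i x hx]; omega), mul_zero]

/-- The sign of the position of a basis element. -/
def sign [DecidableEq ι] (C : LabeledComplex K n ι) : Matrix ι ι K :=
  diagonal fun i => (-1) ^ C.pos i

lemma sign_mul_sign [DecidableEq ι] (C : LabeledComplex K n ι) : C.sign * C.sign = 1 := by
  rw [sign, diagonal_mul_diagonal, ← diagonal_one]
  congr 1
  funext i
  rw [← mul_pow]
  simp

lemma sign_mul [DecidableEq ι] (C : LabeledComplex K n ι) {M : Matrix ι ι K}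
    (hM : ∀ i j, M i j ≠ 0 → C.pos j = C.pos i + 1 ∨ C.pos i = C.pos j + 1) :
    C.sign * M = -(M * C.sign) := by
  ext i j
  rw [sign, diagonal_mul, Matrix.neg_apply, mul_diagonal]
  by_cases h : M i j = 0
  · simp [h]
  · rcases hM i j h with h | h <;> rw [h, pow_succ] <;> ring

open scoped Kronecker

lemma _root_.Matrix.neg_kronecker {l m p q R : Type*} [Mul R] [HasDistribNeg R]
    (A : Matrix l m R) (B : Matrix p q R) : (-A) ⊗ₖ B = -(A ⊗ₖ B) := by
  ext ⟨i, i'⟩ ⟨j, j'⟩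
  exact neg_mul _ _

/-- The total complex of the tensor product of two complexes, with the least common multiples
of the labels. -/
noncomputable def prod [DecidableEq ι] [DecidableEq κ] (C : LabeledComplex K n ι)
    (C' : LabeledComplex K n κ) :
    LabeledComplex K n (ι × κ) where
  d := C.d ⊗ₖ 1 + C.sign ⊗ₖ C'.d
  pos b := C.pos b.1 + C'.pos b.2
  lab b := C.lab b.1 ⊔ C'.lab b.2
  d_pos := by
    rintro ⟨i, i'⟩ ⟨j, j'⟩ h
    rw [Matrix.add_apply, kroneckerMap_apply, kroneckerMap_apply] at h
    by_cases h1 : C.d i j * (1 : Matrix κ κ K) i' j' = 0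
    · rw [h1, zero_add] at h
      have hij : i = j := by
        by_contra hij
        exact left_ne_zero_of_mul h (diagonal_apply_ne _ hij)
      have := C'.d_pos i' j' (right_ne_zero_of_mul h)
      subst hij
      dsimp only
      omega
    · have hij : i' = j' := by
        by_contra hij
        exact right_ne_zero_of_mul h1 (Matrix.one_apply_ne hij)
      have := C.d_pos i j (left_ne_zero_of_mul h1)
      subst hij
      dsimp only
      omega
  d_lab := by
    rintro ⟨i, i'⟩ ⟨j, j'⟩ h
    rw [Matrix.add_apply, kroneckerMap_apply, kroneckerMap_apply] at h
    by_cases h1 : C.d i j * (1 : Matrix κ κ K) i' j' = 0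
    · rw [h1, zero_add] at h
      have hij : i = j := by
        by_contra hij
        exact left_ne_zero_of_mul h (diagonal_apply_ne _ hij)
      have := C'.d_lab i' j' (right_ne_zero_of_mul h)
      subst hij
      exact sup_le_sup_left this _
    · have hij : i' = j' := by
        by_contra hij
        exact right_ne_zero_of_mul h1 (Matrix.one_apply_ne hij)
      have := C.d_lab i j (left_ne_zero_of_mul h1)
      subst hij
      exact sup_le_sup_right this _
  d_sq := by
    rw [Matrix.add_mul, Matrix.mul_add, Matrix.mul_add, ← mul_kronecker_mul, ← mul_kronecker_mul,
      ← mul_kronecker_mul, ← mul_kronecker_mul, C.d_sq, C'.d_sq,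
      C.sign_mul (fun i j h => Or.inl (C.d_pos i j h)), Matrix.mul_one, Matrix.one_mul]
    simp [neg_kronecker]

/-- The homotopy is `s ⊗ 1`: the sign matrix anticommutes with `s`, so the cross terms cancel. -/
lemma IsContractible.prod_left [DecidableEq ι] [DecidableEq κ] {C : LabeledComplex K n ι}
    {c : Fin n →₀ ℕ} (hC : C.IsContractible c) (C' : LabeledComplex K n κ) :
    (C.prod C').IsContractible c := by
  obtain ⟨s, hpos, hlab, h⟩ := hC
  have hone {i' j' : κ} {x : K} (h : x * (1 : Matrix κ κ K) i' j' ≠ 0) : i' = j' := by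
    by_contra hij
    exact right_ne_zero_of_mul h (Matrix.one_apply_ne hij)
  refine ⟨s ⊗ₖ 1, ?_, ?_, ?_⟩
  · rintro ⟨i, i'⟩ ⟨j, j'⟩ hs
    have h1 := hone hs
    have := hpos i j (left_ne_zero_of_mul hs)
    subst h1
    change C.pos i + C'.pos i' = C.pos j + C'.pos i' + 1
    omega
  · rintro ⟨i, i'⟩ ⟨j, j'⟩ hs hle
    have h1 := hone hs
    subst h1
    have hle : C.lab j ⊔ C'.lab i' ≤ c := hle
    exact sup_le (hlab i j (left_ne_zero_of_mul hs) (le_sup_left.trans hle))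
      (le_sup_right.trans hle)
  · have key : (C.prod C').d * (s ⊗ₖ 1) + (s ⊗ₖ 1) * (C.prod C').d =
        (C.d * s + s * C.d) ⊗ₖ (1 : Matrix κ κ K) := by
      rw [prod, Matrix.add_mul, Matrix.mul_add, ← mul_kronecker_mul, ← mul_kronecker_mul,
        ← mul_kronecker_mul, ← mul_kronecker_mul, Matrix.mul_one, Matrix.mul_one, Matrix.one_mul,
        C.sign_mul (fun i j h => Or.inr (hpos i j h)), add_kronecker, neg_kronecker]
      abel
    rintro ⟨i, i'⟩ ⟨j, j'⟩ hle
    have hle : C.lab j ⊔ C'.lab j' ≤ c := hle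
    rw [key, kroneckerMap_apply, h i j (le_sup_left.trans hle), ← one_kronecker_one,
      kroneckerMap_apply]

/-- The homotopy is `sign ⊗ s`: its cross terms cancel since the sign anticommutes with `C.d`, and
the sign squares to `1`. -/
lemma IsContractible.prod_right [DecidableEq ι] [DecidableEq κ] {C' : LabeledComplex K n κ}
    {c : Fin n →₀ ℕ} (hC : C'.IsContractible c) (C : LabeledComplex K n ι) :
    (C.prod C').IsContractible c := by
  obtain ⟨s, hpos, hlab, h⟩ := hC
  have hdiag {i j : ι} {x : K} (h : C.sign i j * x ≠ 0) : i = j := by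
    by_contra hij
    exact left_ne_zero_of_mul h (diagonal_apply_ne _ hij)
  refine ⟨C.sign ⊗ₖ s, ?_, ?_, ?_⟩
  · rintro ⟨i, i'⟩ ⟨j, j'⟩ hs
    have h1 := hdiag hs
    have := hpos i' j' (right_ne_zero_of_mul hs)
    subst h1
    change C.pos i + C'.pos i' = C.pos i + C'.pos j' + 1
    omega
  · rintro ⟨i, i'⟩ ⟨j, j'⟩ hs hle
    have h1 := hdiag hs
    subst h1
    have hle : C.lab i ⊔ C'.lab j' ≤ c := hle
    exact sup_le (le_sup_left.trans hle)
      (hlab i' j' (right_ne_zero_of_mul hs) (le_sup_right.trans hle))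
  · have key : (C.prod C').d * (C.sign ⊗ₖ s) + (C.sign ⊗ₖ s) * (C.prod C').d =
        (1 : Matrix ι ι K) ⊗ₖ (C'.d * s + s * C'.d) := by
      rw [prod, Matrix.add_mul, Matrix.mul_add, ← mul_kronecker_mul, ← mul_kronecker_mul,
        ← mul_kronecker_mul, ← mul_kronecker_mul, Matrix.mul_one, Matrix.one_mul,
        C.sign_mul (fun i j h => Or.inl (C.d_pos i j h)), kronecker_add, neg_kronecker,
        sign_mul_sign]
      abel
    rintro ⟨i, i'⟩ ⟨j, j'⟩ hle
    have hle : C.lab j ⊔ C'.lab j' ≤ c := hle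
    rw [key, kroneckerMap_apply, h i' j' (le_sup_right.trans hle), ← one_kronecker_one,
      kroneckerMap_apply]

/-- The product of resolutions of `S ⧸ I` and `S ⧸ J` resolves `S ⧸ (I + J)`. -/
theorem IsResolution.prod [DecidableEq ι] [DecidableEq κ] {C : LabeledComplex K n ι}
    {C' : LabeledComplex K n κ} {U U' : Set (Fin n →₀ ℕ)} (hU : IsUpperSet U)
    (hU' : IsUpperSet U') {o : ι} {o' : κ} (hC : C.IsResolution U o)
    (hC' : C'.IsResolution U' o') : (C.prod C').IsResolution (U ∪ U') (o, o') := by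
  refine ⟨?_, ?_, ?_, ?_⟩
  · rintro ⟨b, b'⟩
    change C.pos b + C'.pos b' = 0 ↔ _
    rw [Nat.add_eq_zero_iff, hC.pos_eq_zero, hC'.pos_eq_zero, Prod.mk.injEq]
  · change C.lab o ⊔ C'.lab o' = 0
    rw [hC.lab_base, hC'.lab_base, sup_idem]
  · rintro ⟨b, b'⟩ h
    by_cases hb : b = o
    · right
      exact hU' le_sup_right (hC'.lab_mem b' fun h' => h (by rw [hb, h']))
    · left
      exact hU le_sup_left (hC.lab_mem b hb)
  · rintro c (hc | hc) v hv - hd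
    · exact ((C.isContractible_of_exact c fun v hv hd =>
        hC.exact c hc v hv (fun _ _ => ENat.natCast_lt_top _) hd).prod_left C').exact hv hd
    · exact ((C'.isContractible_of_exact c fun v hv hd =>
        hC'.exact c hc v hv (fun _ _ => ENat.natCast_lt_top _) hd).prod_right C).exact hv hd

end LabeledComplex

/-! ### Homogenization to free modules over `S` -/

namespace LabeledComplex

variable {K : Type u} [Field K] {n : ℕ} {ι : Type} [Fintype ι]

/-- The differential of the complex of free `S`-modules, homogenized by the labels. -/
noncomputable def polyDiff (C : LabeledComplex K n ι) : Matrix ι ι (MvPolynomial (Fin n) K) :=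
  of fun i j => monomial (C.lab j - C.lab i) (C.d i j)

lemma polyDiff_apply (C : LabeledComplex K n ι) (i j : ι) :
    C.polyDiff i j = monomial (C.lab j - C.lab i) (C.d i j) := rfl

lemma pos_of_polyDiff_ne_zero (C : LabeledComplex K n ι) {i j : ι} (h : C.polyDiff i j ≠ 0) :
    C.pos j = C.pos i + 1 :=
  C.d_pos i j fun h0 => h (by rw [polyDiff_apply, h0, monomial_zero])

open Classical in
/-- The component of multidegree `c` of a vector over `S`. -/
noncomputable def component (C : LabeledComplex K n ι) (c : Fin n →₀ ℕ)
    (v : ι → MvPolynomial (Fin n) K) : ι → K :=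
  fun b => if C.lab b ≤ c then coeff (c - C.lab b) (v b) else 0

lemma component_mem (C : LabeledComplex K n ι) (c : Fin n →₀ ℕ)
    (v : ι → MvPolynomial (Fin n) K) : C.component c v ∈ C.part c := by
  intro b hb
  by_contra h
  exact hb (if_neg h)

lemma component_zero (C : LabeledComplex K n ι) (c : Fin n →₀ ℕ) : C.component c 0 = 0 := by
  funext b
  simp [component]

lemma ne_zero_of_component_ne_zero (C : LabeledComplex K n ι) {c : Fin n →₀ ℕ}
    {v : ι → MvPolynomial (Fin n) K} {b : ι} (h : C.component c v b ≠ 0) : v b ≠ 0 := by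
  intro h0
  simp [component, h0] at h

/-- This identifies the multidegree `c` strand of the complex over `S` with `C.part c`. -/
lemma component_polyDiff (C : LabeledComplex K n ι) (c : Fin n →₀ ℕ)
    (v : ι → MvPolynomial (Fin n) K) :
    C.component c (C.polyDiff *ᵥ v) = C.d *ᵥ C.component c v := by
  classical
  funext i
  have h (j : ι) : (if C.lab i ≤ c then coeff (c - C.lab i) (C.polyDiff i j * v j) else 0) =
      C.d i j * C.component c v j := by
    by_cases h0 : C.d i j = 0
    · rw [polyDiff_apply, h0, monomial_zero, zero_mul, zero_mul, coeff_zero, ite_self]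
    · have hij := C.d_lab i j h0
      rw [component]
      by_cases hj : C.lab j ≤ c
      · rw [if_pos hj, if_pos (hij.trans hj), polyDiff_apply, coeff_monomial_mul',
          if_pos (tsub_le_tsub_right hj _), tsub_tsub_tsub_cancel_right hij]
      · rw [if_neg hj, mul_zero]
        by_cases hi : C.lab i ≤ c
        · rw [if_pos hi, polyDiff_apply, coeff_monomial_mul', if_neg]
          intro hle
          apply hj
          rwa [tsub_le_iff_right, tsub_add_cancel_of_le hi] at hle
        · rw [if_neg hi]
  rw [mulVec, dotProduct, ← Finset.sum_congr rfl fun j _ => h j, component, mulVec, dotProduct]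
  split_ifs
  · rw [coeff_sum]
  · rw [Finset.sum_const_zero]

lemma ext_component (C : LabeledComplex K n ι) {v w : ι → MvPolynomial (Fin n) K}
    (h : ∀ c, C.component c v = C.component c w) : v = w := by
  funext b
  ext m
  have := congrFun (h (m + C.lab b)) b
  simpa [component] using this

lemma exists_component_eq_zero (C : LabeledComplex K n ι) (v : ι → MvPolynomial (Fin n) K) :
    ∃ T : Finset (Fin n →₀ ℕ), ∀ c ∉ T, C.component c v = 0 := by
  classical
  refine ⟨Finset.univ.biUnion fun b => (v b).support.image (· + C.lab b), fun c hc => ?_⟩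
  funext b
  by_contra h
  have hb := C.component_mem c v b h
  apply hc
  rw [Finset.mem_biUnion]
  refine ⟨b, Finset.mem_univ b, Finset.mem_image.2 ⟨c - C.lab b, ?_, tsub_add_cancel_of_le hb⟩⟩
  rw [mem_support_iff]
  rwa [component, if_pos hb] at h

lemma exists_component_eq (C : LabeledComplex K n ι) (w : (Fin n →₀ ℕ) → ι → K)
    (hw : ∀ c, w c ∈ C.part c) (T : Finset (Fin n →₀ ℕ)) (hT : ∀ c ∉ T, w c = 0) :
    ∃ v, ∀ c, C.component c v = w c := by
  classical
  refine ⟨fun b => ∑ c ∈ T with C.lab b ≤ c, monomial (c - C.lab b) (w c b), fun c => ?_⟩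
  funext b
  rw [component]
  split_ifs with hb
  · rw [coeff_sum, Finset.sum_eq_single c]
    · rw [coeff_monomial, if_pos rfl]
    · intro c' hc' hne
      rw [coeff_monomial, if_neg]
      intro h
      apply hne
      rw [← tsub_add_cancel_of_le (Finset.mem_filter.1 hc').2, h, tsub_add_cancel_of_le hb]
    · intro hc
      rw [coeff_monomial, if_pos rfl, hT c fun h => hc (Finset.mem_filter.2 ⟨h, hb⟩)]
      rfl
  · by_contra h
    exact hb (hw c b (Ne.symm h))

lemma polyDiff_polyDiff (C : LabeledComplex K n ι) (v : ι → MvPolynomial (Fin n) K) :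
    C.polyDiff *ᵥ (C.polyDiff *ᵥ v) = 0 :=
  C.ext_component fun c => by
    rw [component_polyDiff, component_polyDiff, mulVec_mulVec, C.d_sq, zero_mulVec,
      component_zero]

/-- The equation is solved one multidegree at a time. Choosing `0` wherever `v` has no component
leaves finitely many solutions to glue. -/
lemma IsResolutionBelow.polyDiff_exact {C : LabeledComplex K n ι} {U : Set (Fin n →₀ ℕ)} {o : ι}
    (hC : C.IsResolution U o) {v : ι → MvPolynomial (Fin n) K} (hd : C.polyDiff *ᵥ v = 0)
    (hv : ∀ c, C.component c v ≠ 0 → c ∈ U) : ∃ w, C.polyDiff *ᵥ w = v := by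
  classical
  have h (c : Fin n →₀ ℕ) : ∃ w ∈ C.part c, C.d *ᵥ w = C.component c v ∧
      (C.component c v = 0 → w = 0) := by
    by_cases h0 : C.component c v = 0
    · exact ⟨0, Submodule.zero_mem _, by rw [mulVec_zero, h0], fun _ => rfl⟩
    · obtain ⟨w, hw, hwv⟩ := hC.exact c (hv c h0) _ (C.component_mem c v)
        (fun _ _ => ENat.natCast_lt_top _) (by rw [← component_polyDiff, hd, component_zero])
      exact ⟨w, hw, hwv, fun h => absurd h h0⟩
  choose w hw hwv hw0 using h
  obtain ⟨T, hT⟩ := C.exists_component_eq_zero v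
  obtain ⟨x, hx⟩ := C.exists_component_eq w hw T fun c hc => hw0 c (hT c hc)
  exact ⟨x, C.ext_component fun c => by rw [component_polyDiff, hx, hwv]⟩

/-- The number of basis elements in a position. -/
noncomputable def rankAt (C : LabeledComplex K n ι) (k : ℕ) : ℕ := Nat.card {b // C.pos b = k}

/-- An enumeration of the basis elements in a position. -/
noncomputable def enum (C : LabeledComplex K n ι) (k : ℕ) (a : Fin (C.rankAt k)) : ι :=
  ((Finite.equivFin {b // C.pos b = k}).symm a).1

lemma pos_enum (C : LabeledComplex K n ι) (k : ℕ) (a : Fin (C.rankAt k)) :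
    C.pos (C.enum k a) = k :=
  ((Finite.equivFin {b // C.pos b = k}).symm a).2

lemma enum_injective (C : LabeledComplex K n ι) (k : ℕ) : Function.Injective (C.enum k) :=
  Subtype.val_injective.comp (Equiv.injective _)

lemma exists_enum_eq (C : LabeledComplex K n ι) {k : ℕ} {b : ι} (h : C.pos b = k) :
    ∃ a, C.enum k a = b :=
  ⟨Finite.equivFin {b // C.pos b = k} ⟨b, h⟩, congrArg Subtype.val (Equiv.symm_apply_apply _ _)⟩

lemma sum_enum (C : LabeledComplex K n ι) {k : ℕ} {A : Type*} [AddCommMonoid A] {f : ι → A}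
    (hf : ∀ b, f b ≠ 0 → C.pos b = k) : ∑ b, f b = ∑ a, f (C.enum k a) := by
  refine (Fintype.sum_of_injective _ (C.enum_injective k) _ _ (fun b hb => ?_) fun _ => rfl).symm
  by_contra h
  exact hb (C.exists_enum_eq (hf b h))

/-- The differential from position `k + 1` to position `k`. -/
noncomputable def diffAt (C : LabeledComplex K n ι) (k : ℕ) :
    Matrix (Fin (C.rankAt k)) (Fin (C.rankAt (k + 1))) (MvPolynomial (Fin n) K) :=
  C.polyDiff.submatrix (C.enum k) (C.enum (k + 1))

/-- Extension by zero of a vector in position `k`. -/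
noncomputable def extendAt (C : LabeledComplex K n ι) (k : ℕ)
    (x : Fin (C.rankAt k) → MvPolynomial (Fin n) K) : ι → MvPolynomial (Fin n) K :=
  Function.extend (C.enum k) x 0

lemma extendAt_enum (C : LabeledComplex K n ι) (k : ℕ)
    (x : Fin (C.rankAt k) → MvPolynomial (Fin n) K) (a : Fin (C.rankAt k)) :
    C.extendAt k x (C.enum k a) = x a :=
  (C.enum_injective k).extend_apply _ _ _

lemma pos_of_extendAt_ne_zero (C : LabeledComplex K n ι) {k : ℕ}
    {x : Fin (C.rankAt k) → MvPolynomial (Fin n) K} {b : ι} (h : C.extendAt k x b ≠ 0) :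
    C.pos b = k := by
  by_contra hb
  refine h (Function.extend_apply' _ _ _ ?_)
  rintro ⟨a, rfl⟩
  exact hb (C.pos_enum k a)

lemma polyDiff_mulVec_enum (C : LabeledComplex K n ι) (k : ℕ)
    (w : ι → MvPolynomial (Fin n) K) (a : Fin (C.rankAt k)) :
    (C.polyDiff *ᵥ w) (C.enum k a) = (C.diffAt k *ᵥ (w ∘ C.enum (k + 1))) a := by
  rw [mulVec, dotProduct, C.sum_enum (k := k + 1)]
  · rfl
  · intro b hb
    rw [C.pos_of_polyDiff_ne_zero (left_ne_zero_of_mul hb), C.pos_enum]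

lemma extendAt_comp_enum (C : LabeledComplex K n ι) (k : ℕ)
    (x : Fin (C.rankAt k) → MvPolynomial (Fin n) K) : C.extendAt k x ∘ C.enum k = x :=
  funext fun a => C.extendAt_enum k x a

lemma polyDiff_extendAt (C : LabeledComplex K n ι) (k : ℕ)
    (x : Fin (C.rankAt (k + 1)) → MvPolynomial (Fin n) K) :
    C.polyDiff *ᵥ C.extendAt (k + 1) x = C.extendAt k (C.diffAt k *ᵥ x) := by
  funext i
  by_cases hi : C.pos i = k
  · obtain ⟨a, rfl⟩ := C.exists_enum_eq hi
    rw [extendAt_enum, polyDiff_mulVec_enum, extendAt_comp_enum]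
  · have h1 : C.extendAt k (C.diffAt k *ᵥ x) i = 0 := by
      by_contra h
      exact hi (C.pos_of_extendAt_ne_zero h)
    rw [h1, mulVec, dotProduct]
    refine Finset.sum_eq_zero fun j _ => ?_
    by_contra h
    have h2 := C.pos_of_polyDiff_ne_zero (left_ne_zero_of_mul h)
    have h3 := C.pos_of_extendAt_ne_zero (right_ne_zero_of_mul h)
    omega

lemma extendAt_zero (C : LabeledComplex K n ι) (k : ℕ) : C.extendAt k 0 = 0 := by
  funext i
  by_contra h
  obtain ⟨a, rfl⟩ := C.exists_enum_eq (C.pos_of_extendAt_ne_zero h)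
  exact h (C.extendAt_enum k 0 a)

lemma diffAt_diffAt (C : LabeledComplex K n ι) (k : ℕ)
    (x : Fin (C.rankAt (k + 2)) → MvPolynomial (Fin n) K) :
    C.diffAt k *ᵥ (C.diffAt (k + 1) *ᵥ x) = 0 := by
  rw [← C.extendAt_comp_enum k (C.diffAt k *ᵥ (C.diffAt (k + 1) *ᵥ x)), ← polyDiff_extendAt,
    ← polyDiff_extendAt, polyDiff_polyDiff]
  rfl

lemma IsResolutionBelow.range_diffAt {C : LabeledComplex K n ι} {U : Set (Fin n →₀ ℕ)} {o : ι}
    (hC : C.IsResolution U o) (hU : IsUpperSet U) (k : ℕ) :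
    LinearMap.range (C.diffAt (k + 1)).mulVecLin = LinearMap.ker (C.diffAt k).mulVecLin := by
  apply le_antisymm
  · rintro _ ⟨x, rfl⟩
    exact C.diffAt_diffAt k x
  · intro x hx
    have hx : C.diffAt k *ᵥ x = 0 := hx
    obtain ⟨w, hw⟩ := hC.polyDiff_exact (v := C.extendAt (k + 1) x)
      (by rw [polyDiff_extendAt, hx, extendAt_zero])
      -- Away from position `0` a nonzero component lies above a label in `U`.
      (fun c hc => by
        obtain ⟨b, hb⟩ := Function.ne_iff.1 hc
        have hpos := C.pos_of_extendAt_ne_zero (C.ne_zero_of_component_ne_zero hb)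
        refine hU (C.component_mem c _ b hb) (hC.lab_mem b fun h => ?_)
        rw [(hC.pos_eq_zero b).2 h] at hpos
        omega)
    refine ⟨w ∘ C.enum (k + 2), funext fun a => ?_⟩
    rw [mulVecLin_apply, ← polyDiff_mulVec_enum, hw, extendAt_enum]

section Ideal

variable {U : Set (Fin n →₀ ℕ)} {I : Ideal (MvPolynomial (Fin n) K)}
  {C : LabeledComplex K n ι} {o : ι}

lemma IsResolutionBelow.exists_enum_zero (hC : C.IsResolution U o) : ∃ a, C.enum 0 a = o :=
  C.exists_enum_eq ((hC.pos_eq_zero o).2 rfl)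

lemma IsResolutionBelow.linearCombination_eq (hC : C.IsResolution U o)
    (x : Fin (C.rankAt 1) → MvPolynomial (Fin n) K) (a : Fin (C.rankAt 0)) :
    Fintype.linearCombination (MvPolynomial (Fin n) K)
      (fun b => C.polyDiff o (C.enum 1 b)) x = (C.diffAt 0 *ᵥ x) a := by
  have ha : C.enum 0 a = o := (hC.pos_eq_zero _).1 (C.pos_enum 0 a)
  rw [Fintype.linearCombination_apply, mulVec, dotProduct]
  refine Finset.sum_congr rfl fun b _ => ?_
  rw [diffAt, submatrix_apply, ha, smul_eq_mul, mul_comm]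

lemma IsResolutionBelow.range_linearCombination (hC : C.IsResolution U o)
    (hI : ∀ f, f ∈ I ↔ ∀ m ∈ f.support, m ∈ U) :
    LinearMap.range (Fintype.linearCombination (MvPolynomial (Fin n) K)
      (fun b => C.polyDiff o (C.enum 1 b))) = I := by
  classical
  apply le_antisymm
  · rintro _ ⟨x, rfl⟩
    rw [Fintype.linearCombination_apply]
    refine Submodule.sum_mem _ fun b _ => Submodule.smul_mem _ _ ((hI _).2 fun m hm => ?_)
    rw [polyDiff_apply, hC.lab_base, tsub_zero] at hm
    rw [Finset.mem_singleton.1 (support_monomial_subset hm)]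
    refine hC.lab_mem _ fun h => ?_
    have h1 := C.pos_enum 1 b
    rw [(hC.pos_eq_zero _).2 h] at h1
    exact zero_ne_one h1
  · intro f hf
    obtain ⟨a, ha⟩ := hC.exists_enum_zero
    have ho : C.pos o = 0 := (hC.pos_eq_zero o).2 rfl
    -- An element of `I`, seen in position `0`, is a cycle concentrated in multidegrees of `U`.
    obtain ⟨w, hw⟩ := hC.polyDiff_exact (v := Pi.single o f) (by
      funext i
      rw [mulVec, dotProduct]
      refine Finset.sum_eq_zero fun j _ => ?_
      by_contra h
      have h1 := C.pos_of_polyDiff_ne_zero (left_ne_zero_of_mul h)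
      have h2 : j = o := by
        by_contra hj
        exact right_ne_zero_of_mul h (by rw [Pi.single_apply, if_neg hj])
      rw [h2, ho] at h1
      omega) (fun c hc => by
      obtain ⟨b, hb⟩ := Function.ne_iff.1 hc
      have h2 : b = o := by
        by_contra hj
        exact C.ne_zero_of_component_ne_zero hb (by rw [Pi.single_apply, if_neg hj])
      subst h2
      rw [component, hC.lab_base, if_pos zero_le, tsub_zero, Pi.single_eq_same] at hb
      exact (hI f).1 hf c (mem_support_iff.2 hb))
    refine ⟨w ∘ C.enum 1, ?_⟩
    rw [hC.linearCombination_eq _ a, ← polyDiff_mulVec_enum, hw, ha, Pi.single_eq_same]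

/-- The graded free resolution of a monomial ideal `I` that is given by a resolution of `S ⧸ I`. -/
noncomputable def IsResolutionBelow.toGradedFreeResolution (hC : C.IsResolution U o)
    (hU : IsUpperSet U) (hI : ∀ f, f ∈ I ↔ ∀ m ∈ f.support, m ∈ U) :
    GradedFreeResolution I where
  -- Dropping position `0` passes from `S ⧸ I` to `I` and shifts positions by one.
  rank i := C.rankAt (i + 1)
  deg i b := (C.lab (C.enum (i + 1) b)).degree
  gen b := C.polyDiff o (C.enum 1 b)
  diff i := C.diffAt (i + 1)
  gen_homogeneous b m hm := by
    rw [polyDiff_apply, hC.lab_base, tsub_zero] at hm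
    rw [Finset.mem_singleton.1 (support_monomial_subset hm)]
  diff_homogeneous i c b m hm := by
    have hne : C.d (C.enum (i + 1) c) (C.enum (i + 2) b) ≠ 0 := by
      intro h
      rw [diffAt, submatrix_apply, polyDiff_apply, h, monomial_zero] at hm
      simp at hm
    rw [diffAt, submatrix_apply, polyDiff_apply] at hm
    rw [Finset.mem_singleton.1 (support_monomial_subset hm), ← Nat.cast_add, ← map_add,
      tsub_add_cancel_of_le (C.d_lab _ _ hne)]
  range_gen := hC.range_linearCombination hI
  exact_zero := by
    rw [hC.range_diffAt hU 0]
    ext x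
    obtain ⟨a, ha⟩ := hC.exists_enum_zero
    rw [LinearMap.mem_ker, LinearMap.mem_ker, mulVecLin_apply]
    constructor
    · intro h
      rw [hC.linearCombination_eq x a, h]
      rfl
    · intro h
      funext a
      rw [← hC.linearCombination_eq x a, h]
      rfl
  exact_succ i := hC.range_diffAt hU (i + 1)

lemma IsResolutionBelow.isMinimal_toGradedFreeResolution (hC : C.IsResolution U o)
    (hU : IsUpperSet U) (hI : ∀ f, f ∈ I ↔ ∀ m ∈ f.support, m ∈ U) (hmin : C.IsMinimal o) :
    (hC.toGradedFreeResolution hU hI).IsMinimal := by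
  classical
  intro i c b
  change constantCoeff (C.polyDiff (C.enum (i + 1) c) (C.enum (i + 2) b)) = 0
  rw [polyDiff_apply, constantCoeff_eq, coeff_monomial, ite_eq_right_iff]
  intro h
  by_contra hne
  refine absurd (tsub_eq_zero_iff_le.1 h) (not_le_of_gt (hmin _ _ hne fun ho => ?_))
  have h1 := C.pos_enum (i + 1) c
  rw [(hC.pos_eq_zero _).2 ho] at h1
  omega

end Ideal

end LabeledComplex

/-! ### Exponent sets of monomial ideals -/

/-- The exponents of the monomials in the ideal generated by the monomials with exponents in `A`. -/
def exponents {n : ℕ} (A : Set (Fin n →₀ ℕ)) : Set (Fin n →₀ ℕ) := {c | ∃ a ∈ A, a ≤ c}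

lemma isUpperSet_exponents {n : ℕ} (A : Set (Fin n →₀ ℕ)) : IsUpperSet (exponents A) :=
  fun _ _ h ⟨a, ha, hac⟩ => ⟨a, ha, hac.trans h⟩

lemma exponents_union {n : ℕ} (A B : Set (Fin n →₀ ℕ)) :
    exponents (A ∪ B) = exponents A ∪ exponents B := by
  ext c
  simp [exponents, or_and_right, exists_or]

section MonomialIdeal

variable {K : Type u} [Field K] {n : ℕ} {A : Set (Fin n →₀ ℕ)} {I : Ideal (MvPolynomial (Fin n) K)}

lemma mem_iff_support_subset_exponents
    (hI : I = Ideal.span ((fun a => monomial a (1 : K)) '' A)) (f : MvPolynomial (Fin n) K) :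
    f ∈ I ↔ ∀ m ∈ f.support, m ∈ exponents A := by
  rw [hI]
  exact mem_ideal_span_monomial_image

end MonomialIdeal

/-- `M` is the least common multiple of finitely many generators, obtained from Hilbert's basis
theorem over the auxiliary field `ℚ`. -/
lemma exists_inf_mem_exponents {n : ℕ} (A : Set (Fin n →₀ ℕ)) :
    ∃ M : Fin n →₀ ℕ, ∀ c ∈ exponents A, c ⊓ M ∈ exponents A := by
  classical
  have hfg : (Ideal.span ((fun a => monomial a (1 : ℚ)) '' A)).FG := IsNoetherian.noetherian _
  obtain ⟨T, hT, hspan⟩ := (Submodule.fg_span_iff_fg_span_finset_subset _).1 hfg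
  obtain ⟨B, hBA, rfl⟩ := Finset.subset_set_image_iff.1 hT
  rw [Finset.coe_image] at hspan
  refine ⟨B.sup id, fun c hc => ?_⟩
  have h1 : monomial c (1 : ℚ) ∈ Ideal.span ((fun a => monomial a (1 : ℚ)) '' (B : Set _)) := by
    refine hspan.le ((mem_iff_support_subset_exponents rfl _).2 fun m hm => ?_)
    rwa [Finset.mem_singleton.1 (support_monomial_subset hm)]
  obtain ⟨a, ha, hac⟩ := mem_ideal_span_monomial_image.1 h1 c (by simp)
  exact ⟨a, hBA ha, le_inf hac (Finset.le_sup (f := id) ha)⟩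

/-! ### Projective dimension and regularity read off a labelled complex -/

namespace LabeledComplex

variable {K : Type u} [Field K] {n : ℕ} {ι : Type} [Fintype ι]
  {A : Set (Fin n →₀ ℕ)} {I : Ideal (MvPolynomial (Fin n) K)} {C : LabeledComplex K n ι} {o : ι}

lemma rankAt_eq_zero_iff (C : LabeledComplex K n ι) (k : ℕ) :
    C.rankAt k = 0 ↔ ∀ b, C.pos b ≠ k := by
  rw [rankAt, Finite.card_eq_zero_iff, isEmpty_subtype]

lemma IsResolutionBelow.hasProjectiveDimensionLE (hC : C.IsResolution (exponents A) o)
    (hI : I = Ideal.span ((fun a => monomial a (1 : K)) '' A)) {k : ℕ}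
    (hk : ∀ b, C.pos b ≤ k + 1) :
    HasProjectiveDimensionLE (ModuleCat.of (MvPolynomial (Fin n) K) I) k :=
  (hC.toGradedFreeResolution (isUpperSet_exponents A)
    (mem_iff_support_subset_exponents hI)).hasProjectiveDimensionLE_of_rank_eq_zero
    ((C.rankAt_eq_zero_iff (k + 2)).2 fun b hb => by have := hk b; omega)

lemma IsResolutionBelow.pos_le (hC : C.IsResolution (exponents A) o) (hmin : C.IsMinimal o)
    (hI : I = Ideal.span ((fun a => monomial a (1 : K)) '' A)) {k : ℕ}
    (hk : HasProjectiveDimensionLE (ModuleCat.of (MvPolynomial (Fin n) K) I) k) (b : ι) :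
    C.pos b ≤ k + 1 := by
  by_contra! hb
  obtain ⟨l, hl⟩ := Nat.exists_eq_add_of_le hb
  -- Weaken the bound to `k + l = C.pos b - 2`, so that the vanishing rank is the one at the
  -- position of `b`.
  have hkl : HasProjectiveDimensionLE (ModuleCat.of (MvPolynomial (Fin n) K) I) (k + l) := by
    rw [← projectiveDimension_le_iff] at hk ⊢
    exact hk.trans (by exact_mod_cast Nat.le_add_right k l)
  have h0 : C.rankAt (k + l + 1 + 1) = 0 :=
    (hC.isMinimal_toGradedFreeResolution (isUpperSet_exponents A)
      (mem_iff_support_subset_exponents hI) hmin).rank_eq_zero hkl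
  exact (C.rankAt_eq_zero_iff _).1 h0 b (by omega)

lemma IsResolutionBelow.exists_projectiveDimension_eq (hC : C.IsResolution (exponents A) o)
    (hmin : C.IsMinimal o) (hI : I = Ideal.span ((fun a => monomial a (1 : K)) '' A))
    (hI0 : I ≠ ⊥) :
    ∃ p : ℕ, projectiveDimension (ModuleCat.of (MvPolynomial (Fin n) K) I) = p ∧
      ∀ b, C.pos b ≤ p + 1 := by
  have hle := (projectiveDimension_le_iff _ _).2 (hC.hasProjectiveDimensionLE hI
    (k := Finset.univ.sup C.pos)
    fun b => (Finset.le_sup (f := C.pos) (Finset.mem_univ b)).trans (Nat.le_succ _))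
  have hbot : projectiveDimension (ModuleCat.of (MvPolynomial (Fin n) K) I) ≠ ⊥ := by
    rw [Ne, projectiveDimension_eq_bot_iff, ModuleCat.isZero_of_iff_subsingleton,
      Submodule.subsingleton_iff_eq_bot]
    exact hI0
  obtain ⟨p, hp⟩ : ∃ p : ℕ,
      projectiveDimension (ModuleCat.of (MvPolynomial (Fin n) K) I) = p := by
    generalize projectiveDimension (ModuleCat.of (MvPolynomial (Fin n) K) I) = d at hle hbot
    obtain ⟨d, rfl⟩ := WithBot.ne_bot_iff_exists.1 hbot
    have hd : d ≤ (Finset.univ.sup C.pos : ℕ) := by exact_mod_cast hle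
    obtain ⟨p, rfl⟩ := ENat.ne_top_iff_exists.1 (ne_top_of_le_ne_top (ENat.natCast_ne_top _) hd)
    exact ⟨p, rfl⟩
  exact ⟨p, hp, hC.pos_le hmin hI ((projectiveDimension_le_iff _ _).1 hp.le)⟩

lemma IsResolutionBelow.exists_of_torNonzero (hC : C.IsResolution (exponents A) o)
    (hI : I = Ideal.span ((fun a => monomial a (1 : K)) '' A)) {i : ℕ} {j : ℤ}
    (hT : TorNonzero I i j) : ∃ b, C.pos b = i + 1 ∧ ((C.lab b).degree : ℤ) = j := by
  obtain ⟨b, hb⟩ := (hC.toGradedFreeResolution (isUpperSet_exponents A)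
    (mem_iff_support_subset_exponents hI)).exists_deg_eq_of_torNonzero hT
  exact ⟨_, C.pos_enum (i + 1) b, hb⟩

lemma IsResolutionBelow.torNonzero (hC : C.IsResolution (exponents A) o) (hmin : C.IsMinimal o)
    (hI : I = Ideal.span ((fun a => monomial a (1 : K)) '' A)) {i : ℕ} {b : ι}
    (hb : C.pos b = i + 1) : TorNonzero I i (C.lab b).degree := by
  obtain ⟨a, rfl⟩ := C.exists_enum_eq hb
  exact (hC.isMinimal_toGradedFreeResolution (isUpperSet_exponents A)
    (mem_iff_support_subset_exponents hI) hmin).torNonzero i a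

lemma IsResolutionBelow.exists_pos_eq_one (hC : C.IsResolution (exponents A) o)
    (hI : I = Ideal.span ((fun a => monomial a (1 : K)) '' A)) (hI0 : I ≠ ⊥) :
    ∃ b, C.pos b = 1 := by
  by_contra! h
  apply hI0
  rw [← hC.range_linearCombination (mem_iff_support_subset_exponents hI), LinearMap.range_eq_bot]
  have : IsEmpty (Fin (C.rankAt 1)) := by
    rw [(C.rankAt_eq_zero_iff 1).2 h]
    infer_instance
  exact Subsingleton.elim _ _

lemma IsResolutionBelow.one_le_pos {U : Set (Fin n →₀ ℕ)} (hC : C.IsResolution U o) {b : ι}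
    (hb : b ≠ o) : 1 ≤ C.pos b :=
  Nat.one_le_iff_ne_zero.2 fun h => hb ((hC.pos_eq_zero b).1 h)

/-- Every nonzero `Tor` comes from a basis element and, by minimality, conversely. So the regularity
is a maximum over the finite basis without `o`; the `+ 1` is the shift from `S ⧸ I` to `I`. -/
lemma IsResolutionBelow.exists_isRegularity (hC : C.IsResolution (exponents A) o)
    (hmin : C.IsMinimal o) (hI : I = Ideal.span ((fun a => monomial a (1 : K)) '' A))
    (hI0 : I ≠ ⊥) :
    ∃ r : ℤ, IsRegularity I r ∧ ∀ b ≠ o, ((C.lab b).degree : ℤ) + 1 ≤ r + C.pos b := by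
  classical
  obtain ⟨b₁, hb₁⟩ := hC.exists_pos_eq_one hI hI0
  have hne : b₁ ≠ o := fun h => by
    rw [(hC.pos_eq_zero b₁).2 h] at hb₁
    exact zero_ne_one hb₁
  obtain ⟨b₀, hb₀, hmax⟩ := Finset.exists_max_image (Finset.univ.filter (· ≠ o))
    (fun b => ((C.lab b).degree : ℤ) - C.pos b) ⟨b₁, by simpa using hne⟩
  rw [Finset.mem_filter] at hb₀
  have hpos := hC.one_le_pos hb₀.2
  have hbound (b : ι) (hb : b ≠ o) : ((C.lab b).degree : ℤ) + 1 ≤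
      ((C.lab b₀).degree : ℤ) - C.pos b₀ + 1 + C.pos b := by
    have := hmax b (by simpa using hb)
    omega
  refine ⟨((C.lab b₀).degree : ℤ) - C.pos b₀ + 1, ⟨⟨C.pos b₀ - 1, (C.lab b₀).degree,
    hC.torNonzero hmin hI (by omega), by push_cast [hpos]; ring⟩, ?_⟩, hbound⟩
  rintro _ ⟨i, j, hT, rfl⟩
  obtain ⟨b, hb, rfl⟩ := hC.exists_of_torNonzero hI hT
  have := hbound b fun h => by
    rw [(hC.pos_eq_zero b).2 h] at hb
    omega
  omega

end LabeledComplex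

/-! ### Bounds for the regularity and the theorem -/

section Regularity

variable {K : Type u} [Field K] {n : ℕ} {A : Set (Fin n →₀ ℕ)} {I : Ideal (MvPolynomial (Fin n) K)}

lemma zero_mem_exponents_iff (hI : I = Ideal.span ((fun a => monomial a (1 : K)) '' A)) :
    0 ∈ exponents A ↔ I = ⊤ := by
  rw [Ideal.eq_top_iff_one, mem_iff_support_subset_exponents hI]
  constructor
  · intro h m _
    exact isUpperSet_exponents A zero_le h
  · intro h
    refine h 0 ?_
    rw [mem_support_iff, coeff_zero_one]
    exact one_ne_zero

/-- A basis element in position `1` is a generator of `I`, of positive degree if `I` is proper. -/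
lemma LabeledComplex.IsResolutionBelow.nonneg_and_one_le
    (hI : I = Ideal.span ((fun a => monomial a (1 : K)) '' A))
    {ι : Type} [Fintype ι] {C : LabeledComplex K n ι} {o : ι} (hI0 : I ≠ ⊥)
    (hC : C.IsResolution (exponents A) o) {r : ℤ}
    (hr : ∀ b ≠ o, ((C.lab b).degree : ℤ) + 1 ≤ r + C.pos b) : 0 ≤ r ∧ (I ≠ ⊤ → 1 ≤ r) := by
  obtain ⟨b, hb⟩ := hC.exists_pos_eq_one hI hI0
  have hne : b ≠ o := fun h => by
    rw [(hC.pos_eq_zero b).2 h] at hb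
    exact zero_ne_one hb
  have h1 := hr b hne
  refine ⟨by omega, fun htop => ?_⟩
  have h2 : (C.lab b).degree ≠ 0 := fun h => by
    have h3 := hC.lab_mem b hne
    rw [(Finsupp.degree_eq_zero_iff _).1 h, zero_mem_exponents_iff hI] at h3
    exact htop h3
  omega

/-- For the unit ideal `M = 0` is allowed, so there is a resolution with all labels `0`. -/
lemma IsRegularity.nonpos_of_eq_top (hI : I = Ideal.span ((fun a => monomial a (1 : K)) '' A))
    (htop : I = ⊤) {r : ℤ} (hr : IsRegularity I r) : r ≤ 0 := by
  have h0 := (zero_mem_exponents_iff hI).2 htop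
  obtain ⟨ι, _, C, o, hC, -, hM⟩ := LabeledComplex.exists_isMinimal_isResolution K
    (isUpperSet_exponents A) (M := 0) (fun c _ => by rwa [inf_eq_right.2 zero_le])
  obtain ⟨i, j, hT, rfl⟩ := hr.1
  obtain ⟨b, -, rfl⟩ := hC.exists_of_torNonzero hI hT
  rw [nonpos_iff_eq_zero.1 (hM b), map_zero]
  simp

end Regularity

lemma exists_isMinimal_isResolution_exponents (K : Type u) [Field K] {n : ℕ}
    (A : Set (Fin n →₀ ℕ)) :
    ∃ (ι : Type) (_ : Fintype ι) (C : LabeledComplex K n ι) (o : ι),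
      C.IsResolution (exponents A) o ∧ C.IsMinimal o := by
  obtain ⟨M, hM⟩ := exists_inf_mem_exponents A
  obtain ⟨ι, _, C, o, hC, hmin, -⟩ :=
    LabeledComplex.exists_isMinimal_isResolution K (isUpperSet_exponents A) hM
  exact ⟨ι, inferInstance, C, o, hC, hmin⟩

lemma degree_sup_le {n : ℕ} (a b : Fin n →₀ ℕ) : (a ⊔ b).degree ≤ a.degree + b.degree := by
  rw [← map_add]
  exact Finsupp.degree_mono (sup_le le_self_add le_add_self)

theorem corollary3p2 {K : Type u} [Field K] {n : ℕ} (I J : Ideal (MvPolynomial (Fin n) K))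
    (hI : IsMonomialIdeal I) (hJ : IsMonomialIdeal J) (hI0 : I ≠ ⊥) (hJ0 : J ≠ ⊥) :
    projectiveDimension (ModuleCat.of (MvPolynomial (Fin n) K) ↥(I + J)) ≤
        projectiveDimension (ModuleCat.of (MvPolynomial (Fin n) K) ↥I) +
          projectiveDimension (ModuleCat.of (MvPolynomial (Fin n) K) ↥J) + 1 ∧
      (¬(I = ⊤ ∧ J = ⊤) →
        ∃ r s t : ℤ, IsRegularity I r ∧ IsRegularity J s ∧ IsRegularity (I + J) t ∧
          t ≤ r + s - 1) := by
  classical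
  obtain ⟨A, hA⟩ := hI
  obtain ⟨B, hB⟩ := hJ
  have hAB : I + J = Ideal.span ((fun a => monomial a (1 : K)) '' (A ∪ B)) := by
    rw [Set.image_union, Ideal.span_union, ← hA, ← hB]
    rfl
  obtain ⟨ι, _, C, o, hC, hmin⟩ := exists_isMinimal_isResolution_exponents K A
  obtain ⟨κ, _, C', o', hC', hmin'⟩ := exists_isMinimal_isResolution_exponents K B
  have hprod : (C.prod C').IsResolution (exponents (A ∪ B)) (o, o') := by
    rw [exponents_union]
    exact hC.prod (isUpperSet_exponents A) (isUpperSet_exponents B) hC'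
  constructor
  · obtain ⟨p, hp, hpos⟩ := hC.exists_projectiveDimension_eq hmin hA hI0
    obtain ⟨q, hq, hpos'⟩ := hC'.exists_projectiveDimension_eq hmin' hB hJ0
    rw [hp, hq]
    -- Positions in the product are at most `(p + 1) + (q + 1)`, and the shift from `S ⧸ (I + J)` to
    -- `I + J` removes one.
    have h := (projectiveDimension_le_iff _ _).2
      (hprod.hasProjectiveDimensionLE hAB (k := p + q + 1) fun b => by
        have h1 := hpos b.1
        have h2 := hpos' b.2
        change C.pos b.1 + C'.pos b.2 ≤ _
        omega)
    exact_mod_cast h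
  · intro hne
    have hIJ0 : I + J ≠ ⊥ := fun h => hI0 (le_bot_iff.1 (le_sup_left.trans h.le))
    obtain ⟨r, hr, hrb⟩ := hC.exists_isRegularity hmin hA hI0
    obtain ⟨s, hs, hsb⟩ := hC'.exists_isRegularity hmin' hB hJ0
    obtain ⟨μ, _, D, o'', hD, hminD⟩ := exists_isMinimal_isResolution_exponents K (A ∪ B)
    obtain ⟨t, ht, -⟩ := hD.exists_isRegularity hminD hAB hIJ0
    refine ⟨r, s, t, hr, hs, ht, ?_⟩
    obtain ⟨hr0, hr1⟩ := LabeledComplex.IsResolutionBelow.nonneg_and_one_le hA hI0 hC hrb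
    obtain ⟨hs0, hs1⟩ := LabeledComplex.IsResolutionBelow.nonneg_and_one_le hB hJ0 hC' hsb
    by_cases htop : I + J = ⊤
    · have ht0 := ht.nonpos_of_eq_top hAB htop
      by_cases hI1 : I = ⊤
      · have := hs1 fun h => hne ⟨hI1, h⟩
        omega
      · have := hr1 hI1
        omega
    · have h1 := hr1 fun h => htop (top_le_iff.1 (h.ge.trans le_sup_left))
      have h2 := hs1 fun h => htop (top_le_iff.1 (h.ge.trans le_sup_right))
      obtain ⟨i, j, hT, rfl⟩ := ht.1
      -- The extremal `Tor` appears at a pair `(x, y)` with positions adding to `i + 1`. If neither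
      -- is a base element, adding the two bounds gives `r + s - 1`. If one is, the other factor
      -- alone bounds the value by `r` or `s`, and `1 ≤ r`, `1 ≤ s` finish.
      obtain ⟨⟨x, y⟩, hpos, rfl⟩ := hprod.exists_of_torNonzero hAB hT
      have hpos : C.pos x + C'.pos y = i + 1 := hpos
      have hdeg : ((C.prod C').lab (x, y)).degree ≤ (C.lab x).degree + (C'.lab y).degree :=
        degree_sup_le _ _
      by_cases hx : x = o
      · have hx0 := (hC.pos_eq_zero x).2 hx
        have hy := hsb y fun h => by
          have := (hC'.pos_eq_zero y).2 h
          omega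
        have hx1 : (C.lab x).degree = 0 := by rw [hx, hC.lab_base, map_zero]
        omega
      · have hx' := hrb x hx
        by_cases hy : y = o'
        · have hy0 := (hC'.pos_eq_zero y).2 hy
          have hy1 : (C'.lab y).degree = 0 := by rw [hy, hC'.lab_base, map_zero]
          omega
        · have := hsb y hy
          omega
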